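/- Let $\mathbb{K}$ be a field and let $G$ be a finite subgroup of the additive group of $\mathbb{K}$. A \emph{loopless gain graph} $\Gamma$ with gain group $G$ consists of a finite vertex set $V_\Gamma$ and a set $E_\Gamma$ of edges $\{u,v\}_g$ with $u,v\in V_\Gamma$, $u\neq v$, $g\in G$, where $\{u,v\}_g=\{v,u\}_{-g}$. For $W\subseteq V_\Gamma$, the induced subgraph $\Gamma[W]$ has vertex set $W$ and edge set $E_{\Gamma[W]}=\{\{u,v\}_g\in E_\Gamma \mid u,v\in W\}$, and $\Gamma\setminus v:=\Gamma[V_\Gamma\setminus\{v\}]$. For $n\ge 0$, $K_n^G$ is the loopless gain graph on $\{1,\dots,n\}$ with all edges $\{i,j\}_g$, $i\ne j$, $g\in G$ ($K_0^G$ is the null graph, which has no vertices). An isomorphism of gain graphs is a bijection of the vertices preserving edges and non-edges together with their gains. A vertex $v$ is \emph{link simplicial} if, whenever $\{u,v\}_g,\{v,w\}_h\in E_\Gamma$ with $u\neq w$, also $\{u,w\}_{g+h}\in E_\Gamma$. Let $\mathcal{C}^G_+$ be the smallest class of loopless gain graphs with gain group $G$ such that: (i) the null graph belongs to $\mathcal{C}^G_+$;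 (ii) if $\Gamma$ has a link-simplicial vertex $v$ with $\Gamma\setminus v\in\mathcal{C}^G_+$, then $\Gamma\in\mathcal{C}^G_+$; (iii) if $V_\Gamma=V_1\cup V_2$ with $\Gamma[V_1],\Gamma[V_2]\in\mathcal{C}^G_+$, $E_\Gamma=E_{\Gamma[V_1]}\cup E_{\Gamma[V_2]}$, and $\Gamma[V_1\cap V_2]\simeq K_n^G$ for some $n\geq 0$, then $\Gamma\in\mathcal{C}^G_+$. For a loopless gain graph $\Gamma$ with gain group $G$ on the vertex set $\{1,\dots,n\}$, let $\mathcal{A}_+(\Gamma)$ be the arrangement of linear hyperplanes in $\mathbb{K}^{n+1}$, with coordinates $z,x_1,\dots,x_n$, given by $$\mathcal{A}_+(\Gamma)=\{\{z=0\}\}\cup\{\{x_i-x_j=gz\}\mid \{i,j\}_g\in E_\Gamma\}.$$ For a hyperplane arrangement $\mathcal{A}$ (a finite set of linear subspaces of codimension one), let $M(\mathcal{A})$ be the matroid on $\mathcal{A}$ in which $\{H_1,\dots,H_m\}$ (distinct hyperplanes) is independent if and only if $\operatorname{codim}(H_1\cap\dots\cap H_m)=m$. The characteristic polynomial of a matroid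 $M$ on a finite set with rank function $r$ is $\chi(M,t)=\sum_F \mu(\hat 0,F)\,t^{r(M)-r(F)}\in\mathbb{Z}[t]$, the sum being over the flats $F$ of $M$, with $\mu$ the M\"obius function of the lattice of flats and $\hat 0$ the least flat. The arrangement $\mathcal{A}$ is \emph{divisionally free} if $M=M(\mathcal{A})$, of rank $m$ say, has a divisional flag, that is, a chain of flats $\varnothing=X_0\subseteq X_1\subseteq\dots\subseteq X_m=\mathcal{A}$ with $r(X_i)=i$ for $0\le i\le m$ and such that $\chi(M/X_{i+1},t)$ divides $\chi(M/X_i,t)$ in $\mathbb{Z}[t]$ for $0\le i\le m-1$. Then for every $\Gamma\in\mathcal{C}^G_+$ the arrangement $\mathcal{A}_+(\Gamma)$ is divisionally free. -/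

import Mathlib

open Polynomial

universe u v w

/-! ### Finite matroids: characteristic polynomials and divisional flags -/

/-- The poset `L(M)` of flats of a matroid, ordered by inclusion. -/
abbrev FlatLattice {α : Type u} (M : Matroid α) : Type u := {F : Set α // M.IsFlat F}

theorem FlatLattice.finite {α : Type u} (M : Matroid α) [M.Finite] : Finite (FlatLattice M) :=
  Set.Finite.to_subtype
    (s := {F : Set α | M.IsFlat F}) (M.ground_finite.finite_subsets.subset fun _ h => h.subset_ground)

/-- The least flat `0̂`: the closure of the empty set (which is `∅` when there are no loops). -/
def FlatLattice.bot {α : Type u} (M : Matroid α) : FlatLattice M :=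
  ⟨M.closure ∅, M.isFlat_closure ∅⟩

open Classical in
/-- The characteristic polynomial `χ(M, t) = ∑_{F ∈ L(M)} μ(0̂, F) t ^ (r(M) - r(F))`
of a matroid on a finite ground set. -/
noncomputable def Matroid.charPoly {α : Type u} (M : Matroid α) [M.Finite] : ℤ[X] :=
  letI : Finite (FlatLattice M) := FlatLattice.finite M
  letI : Fintype (FlatLattice M) := Fintype.ofFinite _
  letI : LocallyFiniteOrder (FlatLattice M) := Fintype.toLocallyFiniteOrder
  ∑ F : FlatLattice M,
    C (IncidenceAlgebra.mu ℤ (FlatLattice.bot M) F) * X ^ (M.eRank.toNat - (M.eRk F.1).toNat)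

/-- A divisional flag `∅ = X₀ ⊆ X₁ ⊆ ⋯ ⊆ Xₙ = E` of flats of a (simple) matroid of rank `n`:
`r(Xᵢ) = i` and `χ(M/Xᵢ₊₁, t)` divides `χ(M/Xᵢ, t)` in `ℤ[t]`. -/
structure Matroid.IsDivisionalFlag {α : Type u} (M : Matroid α) [M.Finite] {n : ℕ}
    (X : Fin (n + 1) → Set α) : Prop where
  eRank_eq : M.eRank = n
  isFlat : ∀ i, M.IsFlat (X i)
  mono : Monotone X
  zero_eq : X 0 = ∅
  last_eq : X (Fin.last n) = M.E
  eRk_eq : ∀ i, M.eRk (X i) = (i : ℕ)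
  dvd : ∀ i : Fin n, (M.contract (X i.succ)).charPoly ∣ (M.contract (X i.castSucc)).charPoly

/-! ### Central hyperplane arrangements -/

/-- A central hyperplane arrangement: a finite set of linear subspaces of codimension one. -/
structure Arrangement (K : Type u) (W : Type v) [Field K] [AddCommGroup W] [Module K W] where
  carrier : Set (Submodule K W)
  finite : carrier.Finite
  codim_eq_one : ∀ H ∈ carrier, Module.finrank K (W ⧸ H) = 1

section Codim

variable {K : Type u} {W : Type v} [Field K] [AddCommGroup W] [Module K W] [FiniteDimensional K W]

theorem codim_anti {P Q : Submodule K W} (h : P ≤ Q) :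
    Module.finrank K (W ⧸ Q) ≤ Module.finrank K (W ⧸ P) := by
  have h1 := P.finrank_quotient_add_finrank
  have h2 := Q.finrank_quotient_add_finrank
  have h3 := Submodule.finrank_mono h
  omega

theorem codim_inf_le {P H : Submodule K W} (hH : Module.finrank K (W ⧸ H) = 1) :
    Module.finrank K (W ⧸ (H ⊓ P)) ≤ Module.finrank K (W ⧸ P) + 1 := by
  have h1 := P.finrank_quotient_add_finrank
  have h2 := H.finrank_quotient_add_finrank
  have h3 := (H ⊓ P).finrank_quotient_add_finrank
  have h4 := Submodule.finrank_sup_add_finrank_inf_eq H P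
  have h5 := Submodule.finrank_le (H ⊔ P)
  omega

theorem codim_inf_lt {P H : Submodule K W} (h : ¬ P ≤ H) :
    Module.finrank K (W ⧸ P) < Module.finrank K (W ⧸ (H ⊓ P)) := by
  have h1 := P.finrank_quotient_add_finrank
  have h3 := (H ⊓ P).finrank_quotient_add_finrank
  have h4 : Module.finrank K (H ⊓ P : Submodule K W) < Module.finrank K P :=
    Submodule.finrank_lt_finrank_of_lt (inf_lt_right.2 h)
  omega

theorem Arrangement.codim_union_le (A : Arrangement K W) (J : Set (Submodule K W))
    {D : Set (Submodule K W)} (hD : D.Finite) :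
    D ⊆ A.carrier →
      Module.finrank K (W ⧸ sInf (D ∪ J)) ≤ Module.finrank K (W ⧸ sInf J) + D.ncard := by
  induction D, hD using Set.Finite.induction_on with
  | empty => intro _; rw [Set.empty_union, Set.ncard_empty, add_zero]
  | @insert a s ha hs ih =>
    intro h
    have h1 := ih ((Set.subset_insert a s).trans h)
    rw [Set.insert_union, sInf_insert, Set.ncard_insert_of_notMem ha hs]
    have h2 := codim_inf_le (P := sInf (s ∪ J)) (A.codim_eq_one a (h (Set.mem_insert a s)))
    omega

theorem Arrangement.codim_le (A : Arrangement K W) {D : Set (Submodule K W)}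
    (hD : D ⊆ A.carrier) : Module.finrank K (W ⧸ sInf D) ≤ D.ncard := by
  have h := A.codim_union_le ∅ (A.finite.subset hD) hD
  have h0 : Module.finrank K (W ⧸ (⊤ : Submodule K W)) = 0 := by
    have := (⊤ : Submodule K W).finrank_quotient_add_finrank
    rw [finrank_top] at this
    omega
  rw [Set.union_empty, sInf_empty, h0, zero_add] at h
  exact h

/-- The linear dependence matroid `M(A)` on an arrangement: a subset `{H₁, …, Hₙ}` of `A` is
independent if and only if `H₁ ∩ ⋯ ∩ Hₙ` has codimension `n`. -/
def Arrangement.matroid (A : Arrangement K W) : Matroid (Submodule K W) :=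
  (IndepMatroid.ofFinite A.finite
    (fun I => I ⊆ A.carrier ∧ Module.finrank K (W ⧸ sInf I) = I.ncard)
    (by
      refine ⟨Set.empty_subset _, ?_⟩
      have := A.codim_le (Set.empty_subset _)
      simpa using this)
    (by
      rintro I J ⟨hJ, hJc⟩ hIJ
      refine ⟨hIJ.trans hJ, le_antisymm (A.codim_le (hIJ.trans hJ)) ?_⟩
      have hfin := A.finite.subset hJ
      have h := A.codim_union_le I (hfin.subset (Set.sdiff_subset (s := J) (t := I)))
        (Set.sdiff_subset.trans hJ)
      rw [Set.sdiff_union_of_subset hIJ, hJc] at h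
      have h2 := Set.ncard_sdiff_add_ncard_of_subset hIJ hfin
      omega)
    (by
      rintro I J ⟨hI, hIc⟩ ⟨hJ, hJc⟩ hlt
      have hex : ∃ e ∈ J, ¬ sInf I ≤ e := by
        by_contra! hcon
        have := codim_anti (le_sInf hcon)
        omega
      obtain ⟨e, heJ, he⟩ := hex
      have heI : e ∉ I := fun h => he (sInf_le h)
      refine ⟨e, heJ, heI, Set.insert_subset (hJ heJ) hI, ?_⟩
      rw [sInf_insert, Set.ncard_insert_of_notMem heI (A.finite.subset hI)]
      have h1 := codim_inf_le (P := sInf I) (A.codim_eq_one e (hJ heJ))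
      have h2 := codim_inf_lt he
      omega)
    (fun _ h => h.1)).matroid

theorem Arrangement.matroid_ground (A : Arrangement K W) : A.matroid.E = A.carrier := rfl

theorem Arrangement.matroid_indep_iff (A : Arrangement K W) (I : Set (Submodule K W)) :
    A.matroid.Indep I ↔ I ⊆ A.carrier ∧ Module.finrank K (W ⧸ sInf I) = I.ncard := by
  simp [Arrangement.matroid]

instance (A : Arrangement K W) : A.matroid.Finite := ⟨A.finite⟩

/-- An arrangement is divisionally free if its linear dependence matroid has a divisional flag. -/
def Arrangement.DivisionallyFree (A : Arrangement K W) : Prop :=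
  ∃ (n : ℕ) (X : Fin (n + 1) → Set (Submodule K W)), A.matroid.IsDivisionalFlag X

end Codim

/-! ### Loopless gain graphs -/

/-- A loopless gain graph with gain group `G` (written additively). The vertex set is finite, and
`Adj u v g` says that the class `{u, v}_g = {v, u}_{-g}` is an edge; thus the edge set is encoded
as a finite set of triples `(u, v, g)` with `u ≠ v` that is stable under
`(u, v, g) ↦ (v, u, -g)`. -/
structure LooplessGainGraph (G : Type v) [AddGroup G] where
  V : Type u
  finite_vertices : Finite V
  Adj : V → V → G → Prop
  symm : ∀ {u v g}, Adj u v g → Adj v u (-g)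
  ne_of_adj : ∀ {u v g}, Adj u v g → u ≠ v
  finite_edges : {e : V × V × G | Adj e.1 e.2.1 e.2.2}.Finite

namespace LooplessGainGraph

variable {G : Type v} [AddGroup G]

/-- The subgraph `Γ[W]` induced by a set `W` of vertices. -/
def induce (Γ : LooplessGainGraph.{u} G) (W : Set Γ.V) : LooplessGainGraph.{u} G where
  V := W
  finite_vertices := haveI := Γ.finite_vertices; inferInstance
  Adj u v g := Γ.Adj u v g
  symm h := Γ.symm h
  ne_of_adj h e := Γ.ne_of_adj h (congrArg Subtype.val e)
  finite_edges := Γ.finite_edges.preimage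
    (f := fun e : W × W × G => ((e.1 : Γ.V), (e.2.1 : Γ.V), e.2.2)) (by
      rintro ⟨a, b, g⟩ - ⟨a', b', g'⟩ - h
      simp only [Prod.mk.injEq] at h
      exact Prod.ext (Subtype.ext h.1) (Prod.ext (Subtype.ext h.2.1) h.2.2))

/-- The complete loopless gain graph `K_n^G` over a finite group `G`: all the edges `{i, j}_g`
with `i ≠ j` and `g ∈ G`. -/
def complete (G : Type v) [AddGroup G] [Finite G] (n : ℕ) : LooplessGainGraph.{0} G where
  V := Fin n
  finite_vertices := inferInstance
  Adj i j _ := i ≠ j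
  symm h := h.symm
  ne_of_adj h := h
  finite_edges := Set.toFinite _

/-- An isomorphism of gain graphs: a bijection between the vertices that preserves edges and
non-edges, together with their gains. -/
structure Iso (Γ : LooplessGainGraph.{u} G) (Δ : LooplessGainGraph.{w} G) where
  toEquiv : Γ.V ≃ Δ.V
  adj_iff : ∀ u v g, Δ.Adj (toEquiv u) (toEquiv v) g ↔ Γ.Adj u v g

/-- `v` is link simplicial: if `{u, v}_g` and `{v, w}_h` are edges, with `u` and `w` distinct,
then `{u, w}_{g + h}` is an edge. -/
def IsLinkSimplicial (Γ : LooplessGainGraph.{u} G) (v : Γ.V) : Prop :=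
  ∀ (u w : Γ.V) (g h : G), u ≠ w → Γ.Adj u v g → Γ.Adj v w h → Γ.Adj u w (g + h)

/-- The smallest class `C_+^G` of loopless gain graphs with gain group `G` that contains the null
graph and is closed under adding link-simplicial vertices and under gluing along induced
subgraphs isomorphic to some `K_n^G`. -/
inductive ExtendedLiftClass (G : Type v) [AddGroup G] [Finite G] :
    LooplessGainGraph.{u} G → Prop
  | null (Γ : LooplessGainGraph.{u} G) (h : IsEmpty Γ.V) : ExtendedLiftClass G Γ
  | linkSimplicial (Γ : LooplessGainGraph.{u} G) (v : Γ.V) (hv : Γ.IsLinkSimplicial v)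
      (h : ExtendedLiftClass G (Γ.induce {v}ᶜ)) : ExtendedLiftClass G Γ
  | glue (Γ : LooplessGainGraph.{u} G) (V₁ V₂ : Set Γ.V) (hV : V₁ ∪ V₂ = Set.univ)
      (h₁ : ExtendedLiftClass G (Γ.induce V₁)) (h₂ : ExtendedLiftClass G (Γ.induce V₂))
      (hE : ∀ u v g, Γ.Adj u v g → (u ∈ V₁ ∧ v ∈ V₁) ∨ (u ∈ V₂ ∧ v ∈ V₂))
      (n : ℕ) (hn : Nonempty (Iso (Γ.induce (V₁ ∩ V₂)) (complete G n))) :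
      ExtendedLiftClass G Γ

end LooplessGainGraph

/-! ### The arrangement of a loopless gain graph with additive gains -/

section ExtendedLiftArrangement

variable {K : Type v} [Field K]

theorem codim_ker_eq_one {W : Type u} [AddCommGroup W] [Module K W] (φ : W →ₗ[K] K)
    (hφ : φ ≠ 0) : Module.finrank K (W ⧸ LinearMap.ker φ) = 1 := by
  rw [(φ.quotKerEquivOfSurjective (LinearMap.surjective hφ)).finrank_eq, Module.finrank_self]

/-- The hyperplane `{z = 0}` of the space with coordinates `z = x none` and `x_i = x (some i)`. -/
def hyperplaneAtInfinity (K : Type v) [Field K] (V : Type u) : Submodule K (Option V → K) :=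
  LinearMap.ker (LinearMap.proj (R := K) (φ := fun _ : Option V => K) none)

/-- The hyperplane `{x_i - x_j = g z}`. -/
def edgeHyperplane {V : Type u} (i j : V) (g : K) : Submodule K (Option V → K) :=
  LinearMap.ker (LinearMap.proj (R := K) (φ := fun _ : Option V => K) (some i) -
    LinearMap.proj (some j) - g • LinearMap.proj none)

theorem mem_hyperplaneAtInfinity {V : Type u} (x : Option V → K) :
    x ∈ hyperplaneAtInfinity K V ↔ x none = 0 := Iff.rfl

theorem mem_edgeHyperplane {V : Type u} (i j : V) (g : K) (x : Option V → K) :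
    x ∈ edgeHyperplane i j g ↔ x (some i) - x (some j) = g * x none := by
  simp [edgeHyperplane, sub_eq_zero]

/-- The arrangement `A_+(Γ) = {{z = 0}} ∪ {{x_i - x_j = g z} | {i, j}_g ∈ E_Γ}` in `K ^ (n + 1)`
of a loopless gain graph with `n` vertices whose gain group is an additive subgroup of `K`. -/
def LooplessGainGraph.extendedLiftArrangement {G : AddSubgroup K}
    (Γ : LooplessGainGraph.{u} G) : Arrangement K (Option Γ.V → K) where
  carrier := {hyperplaneAtInfinity K Γ.V} ∪
    {H | ∃ (i j : Γ.V) (g : G), Γ.Adj i j g ∧ H = edgeHyperplane i j (g : K)}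
  finite := by
    refine (Set.finite_singleton _).union
      ((Γ.finite_edges.image fun e => edgeHyperplane e.1 e.2.1 (e.2.2 : K)).subset ?_)
    rintro H ⟨i, j, g, h, rfl⟩
    exact ⟨(i, j, g), h, rfl⟩
  codim_eq_one := by
    classical
    rintro H (rfl | ⟨i, j, g, h, rfl⟩)
    · refine codim_ker_eq_one _ fun h => ?_
      simpa using LinearMap.congr_fun h (Pi.single none 1)
    · refine codim_ker_eq_one _ fun h' => ?_
      have hij := Γ.ne_of_adj h
      simpa [Pi.single_apply, hij.symm] using LinearMap.congr_fun h' (Pi.single (some i) 1)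

instance {G : AddSubgroup K} (Γ : LooplessGainGraph.{u} G) : Finite Γ.V := Γ.finite_vertices

end ExtendedLiftArrangement

/-!
Take `G × Fin k` as a set of `t = |G| k` colours, translated by `G`, and call a colouring `x` of the
vertices proper if `x a ≠ g + x b` for every edge `{a, b}_g`. Colourings stand for the points of the
ambient space of `A_+(Γ)` over a field with `t` elements, so that the finite field method applies:
by Möbius inversion, the value at `t` of the characteristic polynomial of `M(A_+(Γ))` contracted by
a flat that avoids `{z = 0}` is, up to a power of `t`, equal to `t - 1` times the number of proper
colourings of the gain graph in which the edges of the flat are contracted. It therefore suffices to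
reduce `Γ` to an edgeless graph by contracting edges one at a time so that the numbers of proper
colourings divide one another.

Contracting an edge at a link-simplicial vertex `v` amounts to deleting `v`, and `v` has
`t - deg v` admissible colours whatever the colours of the other vertices, which gives the
divisibility. When two graphs are glued along `K_n^G`, the numbers of proper colourings satisfy
`P(A₁ ∪ A₂) P(K_n^G) = P(A₁) P(A₂)`, because any two proper colourings of `K_n^G` are exchanged by a
`G`-equivariant permutation of the colours; hence a reduction of `A₂` onto `K_n^G` reduces `A₁ ∪ A₂`
to `A₁` with the same quotients. The induction over the class thus has to provide reductions onto
every complete subgraph, not only onto the edgeless one.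
-/

/-! ### Characteristic polynomials and divisional chains -/

namespace FlatLattice

variable {α : Type u} {M : Matroid α}

theorem coe_bot_contract {X : Set α} (hX : M.IsFlat X) :
    (bot (M.contract X) : Set α) = ∅ := by
  simp [bot, Matroid.contract_closure_eq, hX.closure]

theorem bot_le (F : FlatLattice M) : bot M ≤ F :=
  M.closure_subset_closure (Set.empty_subset F.1) |>.trans F.2.closure.subset

theorem disjoint_of_contract {X F : Set α} (hF : (M.contract X).IsFlat F) : Disjoint F X :=
  Set.disjoint_of_subset_left hF.subset_ground Set.disjoint_sdiff_left

theorem isFlat_contract_iff {X F : Set α} (hX : X ⊆ M.E) (hFX : Disjoint F X) :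
    (M.contract X).IsFlat F ↔ M.IsFlat (F ∪ X) := by
  rw [Matroid.isFlat_iff_closure_eq, Matroid.isFlat_iff_closure_eq, Matroid.contract_closure_eq]
  constructor <;> intro h
  · have hX' : X ⊆ M.closure (F ∪ X) :=
      (M.subset_closure X hX).trans (M.closure_subset_closure Set.subset_union_right)
    rw [← Set.sdiff_union_of_subset hX', h]
  · rw [h, Set.union_sdiff_right, hFX.sdiff_eq_left]

theorem isFlat_contract_sdiff {X F : Set α} (hF : M.IsFlat F) (hXF : X ⊆ F) :
    (M.contract X).IsFlat (F \ X) := by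
  rwa [isFlat_contract_iff (hXF.trans hF.subset_ground) Set.disjoint_sdiff_left,
    Set.sdiff_union_of_subset hXF]

theorem eRk_contract_add_eRk {X Y : Set α} (hX : X ⊆ M.E) (hY : Y ⊆ M.E) (hYX : Disjoint Y X) :
    (M.contract X).eRk Y + M.eRk X = M.eRk (Y ∪ X) := by
  obtain ⟨I, hI⟩ := M.exists_isBasis X hX
  obtain ⟨J, hJ, hIJ⟩ := hI.indep.subset_isBasis_of_subset
    (hI.subset.trans (Set.subset_union_right (s := Y))) (Set.union_subset hY hX)
  have hJI : (M.contract X).IsBasis (J \ I) Y := by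
    have h := hI.contract_sdiff_isBasis_sdiff hJ hIJ
    rw [Set.union_sdiff_right, hYX.sdiff_eq_left] at h
    rw [hI.contract_eq_contract_delete, Matroid.delete_isBasis_iff]
    exact ⟨h, hYX.mono_right Set.sdiff_subset⟩
  rw [hJI.eRk_eq_encard, hI.eRk_eq_encard, hJ.eRk_eq_encard,
    Set.encard_sdiff_add_encard_of_subset hIJ]

variable [M.Finite]

theorem toNat_eRk_contract_add {X Y : Set α} (hX : X ⊆ M.E) (hY : Y ⊆ M.E) (hYX : Disjoint Y X) :
    ((M.contract X).eRk Y).toNat + (M.eRk X).toNat = (M.eRk (Y ∪ X)).toNat := by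
  have hfin (N : Matroid α) [N.Finite] (Z : Set α) : N.eRk Z ≠ ⊤ :=
    N.eRk_ne_top_iff.2 (N.isRkFinite_set Z)
  rw [← eRk_contract_add_eRk hX hY hYX, ENat.toNat_add (hfin _ _) (hfin _ _)]

theorem toNat_eRank_contract_add {X : Set α} (hX : X ⊆ M.E) :
    (M.contract X).eRank.toNat + (M.eRk X).toNat = M.eRank.toNat := by
  have h := toNat_eRk_contract_add hX Set.sdiff_subset (Set.disjoint_sdiff_left (t := M.E))
  rwa [Set.sdiff_union_of_subset hX, Matroid.eRk_ground, ← Matroid.contract_ground,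
    Matroid.eRk_ground] at h

theorem charPoly_contract_ground : (M.contract M.E).charPoly = 1 := by
  have hE : (M.contract M.E).E = ∅ := by rw [Matroid.contract_ground, Set.sdiff_self]
  have hrank : (M.contract M.E).eRank = 0 := by
    rw [← Matroid.eRk_ground, hE, Matroid.eRk_empty]
  have hbot (F : FlatLattice (M.contract M.E)) : F = bot _ :=
    Subtype.ext <| (Set.subset_eq_empty (F.2.subset_ground.trans hE.subset) rfl).trans
      (coe_bot_contract M.ground_isFlat).symm
  rw [Matroid.charPoly, Finset.sum_eq_single (bot _) (fun F _ hF => (hF (hbot F)).elim) (by simp),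
    @IncidenceAlgebra.mu_self]
  simp [hrank]

open Classical in
/-- The counting step of the finite field method: `S ω` plays the role of the set of hyperplanes
through a point `ω` of weight `wt ω`. -/
theorem eval_charPoly_mul {Ω : Type w} [Fintype Ω] (S : Ω → FlatLattice M) (wt : Ω → ℤ) (t c : ℤ)
    (h : ∀ F : FlatLattice M,
      ∑ ω with F ≤ S ω, wt ω = t ^ (M.eRank.toNat - (M.eRk F.1).toNat) * c) :
    M.charPoly.eval t * c = ∑ ω with S ω = bot M, wt ω := by
  let : Finite (FlatLattice M) := FlatLattice.finite M
  let : Fintype (FlatLattice M) := Fintype.ofFinite _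
  let : LocallyFiniteOrder (FlatLattice M) := Fintype.toLocallyFiniteOrder
  calc M.charPoly.eval t * c
      = ∑ F, IncidenceAlgebra.mu ℤ (bot M) F * ∑ ω with F ≤ S ω, wt ω := by
        simp only [h, ← mul_assoc, ← Finset.sum_mul]
        congr 1
        simp only [Matroid.charPoly, eval_finsetSum, eval_mul, eval_C, eval_pow, eval_X]
    _ = ∑ ω, (∑ F ∈ Finset.Icc (bot M) (S ω), IncidenceAlgebra.mu ℤ (bot M) F) * wt ω := by
        simp only [Finset.mul_sum, Finset.sum_mul]
        exact Finset.sum_comm' fun F ω => by simp [bot_le F]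
    _ = ∑ ω with S ω = bot M, wt ω := by
        simp only [IncidenceAlgebra.sum_Icc_mu_right, ite_mul, one_mul, zero_mul,
          Finset.sum_filter, eq_comm]

open Classical in
theorem eval_charPoly_contract_mul {X : Set α} (hX : M.IsFlat X) {Ω : Type w} [Fintype Ω]
    (S : Ω → FlatLattice M) (wt : Ω → ℤ) (t c : ℤ)
    (h : ∀ F : FlatLattice M,
      ∑ ω with F ≤ S ω, wt ω = t ^ (M.eRank.toNat - (M.eRk F.1).toNat) * c) :
    (M.contract X).charPoly.eval t * c = ∑ ω with (S ω).1 = X, wt ω := by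
  have hXE := hX.subset_ground
  let S' : {ω // X ⊆ (S ω).1} → FlatLattice (M.contract X) := fun ω =>
    ⟨(S ω).1 \ X, isFlat_contract_sdiff (S ω).2 ω.2⟩
  have hsum (p : Ω → Prop) (hp : ∀ ω, p ω → X ⊆ (S ω).1) :
      ∑ ω : {ω // X ⊆ (S ω).1} with p ω.1, wt ω.1 = ∑ ω with p ω, wt ω :=
    Finset.sum_nbij (fun ω => ω.1) (by simp) Subtype.val_injective.injOn
      (fun ω hω => ⟨⟨ω, hp ω (by simpa using hω)⟩, by simpa using hω, rfl⟩) (by simp)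
  have hbot (ω) : S' ω = bot _ ↔ (S ω).1 = X := by
    rw [Subtype.ext_iff, coe_bot_contract hX, Set.sdiff_eq_empty]
    exact ⟨fun hω => hω.antisymm ω.2, fun hω => hω.le⟩
  rw [eval_charPoly_mul S' (fun ω => wt ω) t c]
  · simp only [hbot]
    convert hsum (fun ω => (S ω).1 = X) fun ω hω => hω.ge
  · intro F
    have hFX := disjoint_of_contract F.2
    have hFE : F.1 ⊆ M.E := F.2.subset_ground.trans Set.sdiff_subset
    let F' : FlatLattice M := ⟨F.1 ∪ X, (isFlat_contract_iff hXE hFX).1 F.2⟩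
    have hle (ω) : F ≤ S' ω ↔ F' ≤ S ω := by
      simp only [← Subtype.coe_le_coe, S', F', Set.subset_sdiff,
        Set.union_subset_iff, and_iff_left hFX, and_iff_left ω.2]
    simp only [hle]
    rw [hsum (F' ≤ S ·) fun ω hω => Set.subset_union_right.trans hω, h,
      ← toNat_eRank_contract_add hXE, ← toNat_eRk_contract_add hXE hFE hFX,
      Nat.add_sub_add_right]

end FlatLattice

/-- `DivisionalChain M i F` says that the flat `F` of rank `i` is the bottom of a chain of flats
of ranks `i, i + 1, …, r(M)` along which the characteristic polynomials of the contractions divide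
one another, so that `DivisionalChain M 0 ∅` is a divisional flag. -/
inductive DivisionalChain {α : Type u} (M : Matroid α) [M.Finite] : ℕ → Set α → Prop
  | ground {r : ℕ} (hr : M.eRank = r) : DivisionalChain M r M.E
  | step {i : ℕ} {F F' : Set α} (hF : M.IsFlat F) (hi : M.eRk F = i) (hFF' : F ⊆ F')
      (hdvd : (M.contract F').charPoly ∣ (M.contract F).charPoly)
      (h : DivisionalChain M (i + 1) F') : DivisionalChain M i F

theorem DivisionalChain.exists_isDivisionalFlag {α : Type u} {M : Matroid α} [M.Finite]
    (h : DivisionalChain M 0 ∅) :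
    ∃ (n : ℕ) (X : Fin (n + 1) → Set α), M.IsDivisionalFlag X := by
  suffices ∀ {i F}, DivisionalChain M i F → ∃ (n : ℕ) (X : Fin (n + 1) → Set α),
      M.eRank = (i + n : ℕ) ∧ (∀ j, M.IsFlat (X j)) ∧ Monotone X ∧ X 0 = F ∧
      X (Fin.last n) = M.E ∧ (∀ j, M.eRk (X j) = (i + j : ℕ)) ∧
      ∀ j : Fin n, (M.contract (X j.succ)).charPoly ∣ (M.contract (X j.castSucc)).charPoly by
    obtain ⟨n, X, hn, hflat, hmono, h0, hlast, hrk, hdvd⟩ := this h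
    exact ⟨n, X, by simpa using hn, hflat, hmono, h0, hlast, by simpa using hrk, hdvd⟩
  intro i F h
  induction h with
  | ground hr =>
    exact ⟨0, fun _ => M.E, by simpa using hr, fun _ => M.ground_isFlat, monotone_const, rfl, rfl,
      fun j => by simpa [M.eRk_ground] using hr, fun j => j.elim0⟩
  | @step i F F' hF hi hFF' hdvd _ ih =>
    obtain ⟨n, X, hn, hflat, hmono, rfl, hlast, hrk, hX⟩ := ih
    refine ⟨n + 1, Fin.cons F X, ?_, Fin.cases hF hflat, ?_, rfl, hlast, ?_, Fin.cases hdvd hX⟩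
    · rw [hn]; congr 1; omega
    · refine Fin.monotone_iff_le_succ.2 (Fin.cases hFF' fun j => ?_)
      exact hmono (Fin.castSucc_lt_succ).le
    · refine Fin.cases (by simpa using hi) fun j => ?_
      rw [Fin.cons_succ, hrk, Fin.val_succ]; congr 1; omega

namespace Arrangement

variable {K : Type u} {W : Type v} [Field K] [AddCommGroup W] [Module K W] [FiniteDimensional K W]
  (A : Arrangement K W)

theorem sInf_eq_of_isBasis {I F : Set (Submodule K W)} (hI : A.matroid.IsBasis I F) :
    sInf I = sInf F := by
  refine le_antisymm (le_sInf fun H hH => ?_) (sInf_le_sInf hI.subset)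
  by_contra hle
  have hHI : H ∉ I := fun h => hle (sInf_le h)
  have hHE : H ∈ A.carrier := hI.subset_ground hH
  obtain ⟨hIE, hIc⟩ := (A.matroid_indep_iff I).1 hI.indep
  refine hHI (hI.mem_of_insert_indep hH ((A.matroid_indep_iff _).2
    ⟨Set.insert_subset hHE hIE, ?_⟩))
  rw [sInf_insert, Set.ncard_insert_of_notMem hHI (A.finite.subset hIE)]
  have := codim_inf_le (P := sInf I) (A.codim_eq_one H hHE)
  have := codim_inf_lt hle
  omega

theorem eRk_eq_codim {F : Set (Submodule K W)} (hF : F ⊆ A.carrier) :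
    A.matroid.eRk F = Module.finrank K (W ⧸ sInf F) := by
  obtain ⟨I, hI⟩ := A.matroid.exists_isBasis F hF
  obtain ⟨hIE, hIc⟩ := (A.matroid_indep_iff I).1 hI.indep
  rw [hI.eRk_eq_encard, ← A.sInf_eq_of_isBasis hI, hIc,
    (A.finite.subset hIE).cast_ncard_eq]

theorem isFlat_setOf_le (L : Submodule K W) : A.matroid.IsFlat {H | H ∈ A.carrier ∧ L ≤ H} := by
  refine ⟨fun I X hI hX H hH => ⟨hX.subset_ground hH, ?_⟩, fun H hH => hH.1⟩
  have h := (A.sInf_eq_of_isBasis hI).symm.trans (A.sInf_eq_of_isBasis hX)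
  exact (le_sInf fun H hH => hH.2).trans (h.le.trans (sInf_le hH))

open Classical in
theorem eval_charPoly_contract_mul {X : Set (Submodule K W)}
    (hX : A.matroid.IsFlat X) {Ω : Type w} [Fintype Ω] (P : Ω → Submodule K W) (wt : Ω → ℤ) (t : ℤ)
    (h : ∀ F ⊆ A.carrier,
      ∑ ω with P ω ≤ sInf F, wt ω = t ^ Module.finrank K (sInf F : Submodule K W)) :
    (A.matroid.contract X).charPoly.eval t * t ^ Module.finrank K ↥(sInf A.carrier) =
      ∑ ω with {H | H ∈ A.carrier ∧ P ω ≤ H} = X, wt ω := by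
  refine FlatLattice.eval_charPoly_contract_mul hX
    (fun ω => ⟨_, A.isFlat_setOf_le (P ω)⟩) wt t _ fun F => ?_
  have hF : F.1 ⊆ A.carrier := F.2.subset_ground
  have hle (ω) : F ≤ ⟨_, A.isFlat_setOf_le (P ω)⟩ ↔ P ω ≤ sInf F.1 :=
    ⟨fun h => le_sInf fun H hH => (h hH).2, fun h H hH => ⟨hF hH, h.trans (sInf_le hH)⟩⟩
  have hE := (sInf A.carrier).finrank_quotient_add_finrank
  have hF' := (sInf F.1).finrank_quotient_add_finrank
  have hmono := Submodule.finrank_mono (sInf_le_sInf hF)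
  simp only [hle]
  rw [h _ hF, ← Matroid.eRk_ground, A.matroid_ground, A.eRk_eq_codim subset_rfl,
    A.eRk_eq_codim hF, ENat.toNat_natCast, ENat.toNat_natCast, ← pow_add]
  congr 1
  omega

end Arrangement

/-! ### Gain graphs and proper colourings -/

/-- The set of colours `G × Fin k`, on which `G` acts freely by translating the first coordinate. -/
def Colour (G : Type v) (k : ℕ) : Type v := G × Fin k

namespace Colour

variable {G : Type v} {k : ℕ}

instance [Finite G] : Finite (Colour G k) := inferInstanceAs (Finite (G × Fin k))

theorem card_eq : Nat.card (Colour G k) = Nat.card G * k := by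
  rw [Colour, Nat.card_prod, Nat.card_fin]

variable [AddGroup G]

instance : AddAction G (Colour G k) where
  vadd g s := (g + s.1, s.2)
  zero_vadd s := Prod.ext (zero_add s.1) rfl
  add_vadd g h s := Prod.ext (add_assoc g h s.1) rfl

instance : IsCancelVAdd G (Colour G k) where
  left_cancel' _ _ _ h := (vadd_left_cancel_iff _).1 h
  right_cancel' _ _ _ h := add_right_cancel (congrArg Prod.fst h)

theorem eq_vadd_iff {g : G} {s s' : Colour G k} : s = g +ᵥ s' ↔ s.1 = g + s'.1 ∧ s.2 = s'.2 :=
  Prod.ext_iff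

end Colour

/-- A loopless gain graph on a fixed vertex type, infinite graphs included; fixing the vertices
makes the gain graphs a lattice and lets contractions be compared with one another. -/
@[ext] structure GainGraph (V : Type u) (G : Type v) [AddGroup G] where
  Adj : V → V → G → Prop
  symm : ∀ {a b g}, Adj a b g → Adj b a (-g)
  ne_of_adj : ∀ {a b g}, Adj a b g → a ≠ b

namespace GainGraph

section Lattice

variable {V : Type u} {G : Type v} [AddGroup G]

instance : SemilatticeSup (GainGraph V G) where
  le A B := ∀ a b g, A.Adj a b g → B.Adj a b g
  le_refl _ _ _ _ := id
  le_trans _ _ _ hAB hBC a b g h := hBC a b g (hAB a b g h)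
  le_antisymm A B hAB hBA := by
    ext a b g
    exact ⟨hAB a b g, hBA a b g⟩
  sup A B :=
    { Adj a b g := A.Adj a b g ∨ B.Adj a b g
      symm h := h.imp A.symm B.symm
      ne_of_adj h := h.elim A.ne_of_adj B.ne_of_adj }
  le_sup_left _ _ _ _ _ := Or.inl
  le_sup_right _ _ _ _ _ := Or.inr
  sup_le _ _ _ hA hB a b g := Or.rec (hA a b g) (hB a b g)

theorem le_def {A B : GainGraph V G} : A ≤ B ↔ ∀ a b g, A.Adj a b g → B.Adj a b g := Iff.rfl

@[simp] theorem sup_adj {A B : GainGraph V G} {a b : V} {g : G} :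
    (A ⊔ B).Adj a b g ↔ A.Adj a b g ∨ B.Adj a b g := Iff.rfl

/-- The gain graph with all the edges `{a, b}_g` between distinct elements of `S`: a copy of `K_n^G`
together with isolated vertices. -/
def complete (S : Set V) : GainGraph V G where
  Adj a b _ := a ∈ S ∧ b ∈ S ∧ a ≠ b
  symm h := ⟨h.2.1, h.1, h.2.2.symm⟩
  ne_of_adj h := h.2.2

/-- The subgraph of the edges between vertices of `S`, in which the other vertices are isolated. -/
def restrict (A : GainGraph V G) (S : Set V) : GainGraph V G where
  Adj a b g := a ∈ S ∧ b ∈ S ∧ A.Adj a b g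
  symm h := ⟨h.2.1, h.1, A.symm h.2.2⟩
  ne_of_adj h := A.ne_of_adj h.2.2

theorem complete_mono {S T : Set V} (hST : S ⊆ T) :
    (complete S : GainGraph V G) ≤ complete T :=
  fun _ _ _ h => ⟨hST h.1, hST h.2.1, h.2.2⟩

variable {A : GainGraph V G} {S : Set V}

theorem restrict_le_self : A.restrict S ≤ A := fun _ _ _ h => h.2.2

theorem restrict_le_complete : A.restrict S ≤ complete S :=
  fun _ _ _ h => ⟨h.1, h.2.1, A.ne_of_adj h.2.2⟩

theorem le_restrict {B : GainGraph V G} (hS : B ≤ complete S) (hA : B ≤ A) : B ≤ A.restrict S :=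
  fun a b g hab => ⟨(hS a b g hab).1, (hS a b g hab).2.1, hA a b g hab⟩

/-- A colouring `x` is proper if no edge `{a, b}_g` satisfies `x a = g +ᵥ x b`. -/
def IsProper (A : GainGraph V G) {T : Type w} [VAdd G T] (x : V → T) : Prop :=
  ∀ a b g, A.Adj a b g → x a ≠ g +ᵥ x b

/-- The number of proper colourings with colours in `Colour G k`. -/
noncomputable def numProper (A : GainGraph V G) (k : ℕ) : ℕ :=
  Nat.card {x : V → Colour G k // A.IsProper x}

theorem IsProper.mono {A B : GainGraph V G} (hAB : A ≤ B) {T : Type w} [VAdd G T] {x : V → T}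
    (hx : B.IsProper x) : A.IsProper x :=
  fun a b g h => hx a b g (hAB a b g h)

theorem numProper_pos [Finite V] [Finite G] (A : GainGraph V G) {k : ℕ} (hk : Nat.card V ≤ k) :
    0 < A.numProper k := by
  have : Nonempty {x : V → Colour G k // A.IsProper x} := by
    refine ⟨⟨fun a => (0, Fin.castLE hk (Finite.equivFin V a)), fun a b g hab heq => ?_⟩⟩
    exact A.ne_of_adj hab (by simpa using (Colour.eq_vadd_iff.1 heq).2)
  exact Nat.card_pos

end Lattice

section Contract

variable {V : Type u} {V' : Type v} {V'' : Type w} {G : Type*} [AddCommGroup G]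

/-- The gain graph obtained by identifying every vertex `c` with `f c` by means of the gain `p c`,
discarding the loops. For injective `f` this is a relabelling followed by a switching. -/
def contract (A : GainGraph V G) (f : V → V') (p : V → G) : GainGraph V' G where
  Adj a b g := a ≠ b ∧ ∃ c d, f c = a ∧ f d = b ∧ A.Adj c d (g + p c - p d)
  symm := by
    rintro a b g ⟨hab, c, d, hc, hd, h⟩
    refine ⟨hab.symm, d, c, hd, hc, ?_⟩
    convert A.symm h using 1
    abel
  ne_of_adj h := h.1

theorem contract_adj {A : GainGraph V G} {f : V → V'} {p : V → G} {a b : V'} {g : G} :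
    (A.contract f p).Adj a b g ↔ a ≠ b ∧ ∃ c d, f c = a ∧ f d = b ∧ A.Adj c d (g + p c - p d) :=
  Iff.rfl

theorem contract_id (A : GainGraph V G) : A.contract id 0 = A := by
  ext a b g
  simpa [contract_adj] using A.ne_of_adj

theorem contract_contract (A : GainGraph V G) (f : V → V') (p : V → G) (f' : V' → V'')
    (p' : V' → G) :
    (A.contract f p).contract f' p' = A.contract (f' ∘ f) (fun a => p a + p' (f a)) := by
  have hgain (g : G) (c d : V) :
      g + p' (f c) - p' (f d) + p c - p d = g + (p c + p' (f c)) - (p d + p' (f d)) := by abel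
  ext a b g
  constructor
  · rintro ⟨hab, _, _, rfl, rfl, -, c, d, rfl, rfl, h⟩
    exact ⟨hab, c, d, rfl, rfl, by rwa [← hgain]⟩
  · rintro ⟨hab, c, d, rfl, rfl, h⟩
    refine ⟨hab, f c, f d, rfl, rfl, fun e => hab (congrArg f' e), c, d, rfl, rfl, ?_⟩
    rwa [hgain]

theorem contract_mono {A B : GainGraph V G} (hAB : A ≤ B) (f : V → V') (p : V → G) :
    A.contract f p ≤ B.contract f p :=
  fun _ _ _ ⟨hab, c, d, hc, hd, h⟩ => ⟨hab, c, d, hc, hd, hAB _ _ _ h⟩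

theorem contract_sup (A B : GainGraph V G) (f : V → V') (p : V → G) :
    (A ⊔ B).contract f p = A.contract f p ⊔ B.contract f p := by
  ext a b g
  simp only [contract_adj, sup_adj]
  grind

theorem contract_complete (S : Set V) (f : V → V') (p : V → G) :
    (complete S).contract f p = complete (f '' S) := by
  ext a b g
  constructor
  · rintro ⟨hab, c, d, rfl, rfl, hc, hd, -⟩
    exact ⟨⟨c, hc, rfl⟩, ⟨d, hd, rfl⟩, hab⟩
  · rintro ⟨⟨c, hc, rfl⟩, ⟨d, hd, rfl⟩, hab⟩
    exact ⟨hab, c, d, rfl, rfl, hc, hd, fun e => hab (congrArg f e)⟩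

theorem contract_congr {A : GainGraph V G} {S : Set V} (hA : A ≤ complete S) {f f' : V → V'}
    {p p' : V → G} (hf : Set.EqOn f f' S) (hp : Set.EqOn p p' S) :
    A.contract f p = A.contract f' p' := by
  have hle {f f' : V → V'} {p p' : V → G} (hf : Set.EqOn f f' S) (hp : Set.EqOn p p' S) :
      A.contract f p ≤ A.contract f' p' := by
    rintro _ _ g ⟨hab, c, d, rfl, rfl, h⟩
    obtain ⟨hc, hd, -⟩ := hA _ _ _ h
    exact ⟨hab, c, d, (hf hc).symm, (hf hd).symm, by rwa [← hp hc, ← hp hd]⟩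
  exact (hle hf hp).antisymm (hle hf.symm hp.symm)

theorem isProper_contract_iff {A : GainGraph V G} {f : V → V'} {p : V → G} {T : Type*}
    [AddAction G T] {y : V' → T} :
    (A.contract f p).IsProper y ↔ ∀ c d g, A.Adj c d g → f c ≠ f d →
      p c +ᵥ y (f c) ≠ g +ᵥ p d +ᵥ y (f d) := by
  have hgain (c d : V) (g : G) :
      y (f c) = (g - p c + p d) +ᵥ y (f d) ↔ p c +ᵥ y (f c) = g +ᵥ p d +ᵥ y (f d) := by
    rw [← vadd_left_cancel_iff (p c), vadd_vadd, vadd_vadd]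
    congr! 2
    abel
  constructor
  · intro hy c d g h hcd heq
    refine hy _ _ _ ⟨hcd, c, d, rfl, rfl, ?_⟩ ((hgain c d g).2 heq)
    convert h using 1
    abel
  · rintro hy _ _ g ⟨hab, c, d, rfl, rfl, h⟩ heq
    refine hy c d _ h hab ((hgain c d _).1 ?_)
    convert heq using 2
    abel

theorem numProper_contract_equiv (A : GainGraph V G) (σ : V ≃ V') (p : V → G) (k : ℕ) :
    (A.contract σ p).numProper k = A.numProper k := by
  let e : (V' → Colour G k) ≃ (V → Colour G k) :=
    (σ.symm.arrowCongr (.refl _)).trans (Equiv.piCongrRight fun c => AddAction.toPerm (p c))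
  refine Nat.card_congr (e.subtypeEquiv fun y => ?_)
  rw [isProper_contract_iff]
  exact forall₄_congr fun c d g h => ⟨fun H => H (σ.injective.ne (A.ne_of_adj h)), fun H _ => H⟩

end Contract

section Elim

variable {V : Type u} {G : Type v} [AddCommGroup G]

open Classical in
/-- The contraction of the edge `{u, v}_g` into `u`, in which `v` becomes an isolated vertex. -/
noncomputable def elim (A : GainGraph V G) (u v : V) (g : G) : GainGraph V G :=
  A.contract (Function.update id v u) (Pi.single v (-g))

theorem elim_mono {A B : GainGraph V G} (hAB : A ≤ B) (u v : V) (g : G) :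
    A.elim u v g ≤ B.elim u v g :=
  contract_mono hAB _ _

theorem elim_sup (A B : GainGraph V G) (u v : V) (g : G) :
    (A ⊔ B).elim u v g = A.elim u v g ⊔ B.elim u v g :=
  contract_sup _ _ _ _

theorem elim_eq_self {A : GainGraph V G} {S : Set V} (hA : A ≤ complete S) {u v : V} (hv : v ∉ S)
    (g : G) : A.elim u v g = A := by
  have hne {a : V} (ha : a ∈ S) : a ≠ v := fun h => hv (h ▸ ha)
  conv_rhs => rw [← A.contract_id]
  exact contract_congr hA (fun a ha => by simp [hne ha]) (fun a ha => by simp [hne ha])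

theorem elim_le_complete {A : GainGraph V G} {S : Set V} (hA : A ≤ complete S) {u v : V}
    (hu : u ∈ S) (g : G) : A.elim u v g ≤ complete S := by
  refine (contract_mono hA _ _).trans ((contract_complete _ _ _).trans_le (complete_mono ?_))
  rintro _ ⟨a, ha, rfl⟩
  by_cases hav : a = v <;> simp_all

theorem elim_contract_equiv {V' : Type*} (A : GainGraph V G) (σ : V ≃ V') (p : V → G) (u v : V)
    (g : G) : (A.elim u v g).contract σ p = (A.contract σ p).elim (σ u) (σ v) (g - p u + p v) := by
  classical
  rw [elim, elim, contract_contract, contract_contract]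
  congr 1 <;> funext a <;> by_cases ha : a = v <;> simp [ha, sub_eq_neg_add]

open Classical in
theorem elim_symm (A : GainGraph V G) {u v : V} (huv : u ≠ v) (g : G) :
    A.elim v u (-g) = (A.elim u v g).contract (Equiv.swap u v) (Pi.single u g) := by
  rw [elim, elim, contract_contract]
  congr 1 <;> funext a <;> by_cases hv : a = v <;> by_cases hu : a = u <;>
    simp_all [Equiv.swap_apply_of_ne_of_ne]

end Elim

section Sup

variable {V : Type u} {G : Type v} [AddCommGroup G] {k : ℕ}

theorem exists_equivariant_perm {C : Type w} (x y : C → Colour G k)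
    (hx : Function.Injective fun c => (x c).2) (hy : Function.Injective fun c => (y c).2) :
    ∃ φ : Equiv.Perm (Colour G k), (∀ (g : G) s, φ (g +ᵥ s) = g +ᵥ φ s) ∧ ∀ c, φ (y c) = x c := by
  classical
  let e := (Equiv.ofInjective _ hy).symm.trans (Equiv.ofInjective _ hx)
  have hπ (c : C) : e.extendSubtype (y c).2 = (x c).2 := by
    rw [e.extendSubtype_apply_of_mem _ ⟨c, rfl⟩]
    exact congrArg (fun c => (x c).2) ((Equiv.ofInjective _ hy).symm_apply_apply c)
  let δ : Fin k → G := Function.extend (fun c => (y c).2) (fun c => (x c).1 - (y c).1) 0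
  have hδ (c : C) : δ (y c).2 = (x c).1 - (y c).1 := hy.extend_apply _ _ c
  let φ : Equiv.Perm (Colour G k) :=
    { toFun s := (s.1 + δ s.2, e.extendSubtype s.2)
      invFun s := (s.1 - δ (e.extendSubtype.symm s.2), e.extendSubtype.symm s.2)
      left_inv s := Prod.ext (by simp) (by simp)
      right_inv s := Prod.ext (by simp) (by simp) }
  refine ⟨φ, fun g s => Prod.ext (add_assoc _ _ _) rfl, fun c => Prod.ext ?_ (hπ c)⟩
  change (y c).1 + δ (y c).2 = (x c).1
  rw [hδ, add_sub_cancel]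

theorem isProper_complete_iff {C : Set V} {x : V → Colour G k} :
    (complete C : GainGraph V G).IsProper x ↔ C.InjOn fun c => (x c).2 := by
  constructor
  · intro hx a ha b hb hab
    by_contra hne
    exact hx a b ((x a).1 - (x b).1) ⟨ha, hb, hne⟩ (Colour.eq_vadd_iff.2 ⟨by simp, hab⟩)
  · rintro hx a b g ⟨ha, hb, hab⟩ heq
    exact hab (hx ha hb (Colour.eq_vadd_iff.1 heq).2)

theorem isProper_congr {A : GainGraph V G} {S : Set V} (hA : A ≤ complete S) {T : Type w}
    [VAdd G T] {x y : V → T} (φ : Equiv.Perm T) (hφ : ∀ (g : G) s, φ (g +ᵥ s) = g +ᵥ φ s)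
    (hxy : ∀ a ∈ S, x a = φ (y a)) : A.IsProper x ↔ A.IsProper y := by
  refine forall₄_congr fun a b g h => ?_
  obtain ⟨ha, hb, -⟩ := hA a b g h
  rw [hxy a ha, hxy b hb, ← hφ, φ.injective.ne_iff]

open Classical in
/-- Exchanging two functions outside `S`, with a twist that depends on their restrictions to
`C ⊆ S`. -/
noncomputable def twistedSwap {T : Type w} {S C : Set V} (hCS : C ⊆ S)
    (φ : (C → T) → (C → T) → Equiv.Perm T) : Equiv.Perm ((V → T) × (V → T)) where
  toFun q :=
    (S.piecewise q.1 (φ (C.domRestrict q.1) (C.domRestrict q.2) ∘ q.2), S.piecewise q.2 q.1)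
  invFun q :=
    (S.piecewise q.1 q.2, S.piecewise q.2 ((φ (C.domRestrict q.1) (C.domRestrict q.2)).symm ∘ q.1))
  left_inv q := by
    have hC (r r' : V → T) : C.domRestrict (S.piecewise r r') = C.domRestrict r :=
      funext fun c => S.piecewise_eq_of_mem _ _ (hCS c.2)
    refine Prod.ext ?_ ?_ <;> funext a <;> by_cases ha : a ∈ S <;> simp [ha, hC]
  right_inv q := by
    have hC (r r' : V → T) : C.domRestrict (S.piecewise r r') = C.domRestrict r :=
      funext fun c => S.piecewise_eq_of_mem _ _ (hCS c.2)
    refine Prod.ext ?_ ?_ <;> funext a <;> by_cases ha : a ∈ S <;> simp [ha, hC]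

variable {A₁ A₂ : GainGraph V G} {V₁ V₂ : Set V}

open Classical in
theorem isProper_sup_piecewise_iff (h₁ : A₁ ≤ complete V₁) (h₂ : A₂ ≤ complete V₂)
    {T : Type w} [VAdd G T] {x y : V → T} {φ : Equiv.Perm T}
    (hφ : ∀ (g : G) s, φ (g +ᵥ s) = g +ᵥ φ s) (hxy : ∀ a ∈ V₁ ∩ V₂, φ (y a) = x a) :
    (A₁ ⊔ A₂).IsProper (V₁.piecewise x (φ ∘ y)) ↔ A₁.IsProper x ∧ A₂.IsProper y := by
  have hA₁ : A₁.IsProper (V₁.piecewise x (φ ∘ y)) ↔ A₁.IsProper x :=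
    isProper_congr h₁ (.refl _) (fun _ _ => rfl) fun a ha => V₁.piecewise_eq_of_mem _ _ ha
  have hA₂ : A₂.IsProper (V₁.piecewise x (φ ∘ y)) ↔ A₂.IsProper y := by
    refine isProper_congr h₂ φ hφ fun a ha => ?_
    by_cases ha₁ : a ∈ V₁ <;> simp [ha₁, hxy a ⟨_, ha⟩]
  rw [← hA₁, ← hA₂]
  exact ⟨fun h => ⟨h.mono le_sup_left, h.mono le_sup_right⟩,
    fun h a b g hab => hab.elim (h.1 a b g) (h.2 a b g)⟩

theorem numProper_sup_mul_numProper_complete (h₁ : A₁ ≤ complete V₁) (h₂ : A₂ ≤ complete V₂)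
    (hC₁ : complete (V₁ ∩ V₂) ≤ A₁) (hC₂ : complete (V₁ ∩ V₂) ≤ A₂) (k : ℕ) :
    (A₁ ⊔ A₂).numProper k * (complete (V₁ ∩ V₂) : GainGraph V G).numProper k =
      A₁.numProper k * A₂.numProper k := by
  classical
  have hex (x y : (V₁ ∩ V₂ : Set V) → Colour G k) : ∃ φ : Equiv.Perm (Colour G k),
      (∀ (g : G) s, φ (g +ᵥ s) = g +ᵥ φ s) ∧ ((Function.Injective fun c => (x c).2) →
        (Function.Injective fun c => (y c).2) → ∀ c, φ (y c) = x c) := by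
    by_cases h : (Function.Injective fun c => (x c).2) ∧ (Function.Injective fun c => (y c).2)
    · obtain ⟨φ, hφ, hxy⟩ := exists_equivariant_perm x y h.1 h.2
      exact ⟨φ, hφ, fun _ _ => hxy⟩
    · exact ⟨.refl _, fun _ _ => rfl, fun hx hy => absurd ⟨hx, hy⟩ h⟩
  choose φ hφ hφC using hex
  let e := twistedSwap (T := Colour G k) (Set.inter_subset_left (s := V₁) (t := V₂)) φ
  unfold numProper
  rw [← Nat.card_prod, ← Nat.card_prod]
  refine (Nat.card_congr ((Equiv.subtypeProdEquivProd.symm.trans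
    (e.subtypeEquiv ?_)).trans Equiv.subtypeProdEquivProd)).symm
  rintro ⟨x, y⟩
  change A₁.IsProper x ∧ A₂.IsProper y ↔ (A₁ ⊔ A₂).IsProper (V₁.piecewise x (φ _ _ ∘ y)) ∧
    (complete (V₁ ∩ V₂)).IsProper (V₁.piecewise y x)
  have hy : (complete (V₁ ∩ V₂) : GainGraph V G).IsProper (V₁.piecewise y x) ↔
      (complete (V₁ ∩ V₂) : GainGraph V G).IsProper y :=
    isProper_congr le_rfl (.refl _) (fun _ _ => rfl) fun a ha => V₁.piecewise_eq_of_mem _ _ ha.1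
  have hx (r : V → Colour G k) (h : (A₁ ⊔ A₂).IsProper (V₁.piecewise x r)) :
      (complete (V₁ ∩ V₂) : GainGraph V G).IsProper x :=
    (isProper_congr le_rfl (.refl _) (fun _ _ => rfl) fun a ha =>
      V₁.piecewise_eq_of_mem x r ha.1).1 (h.mono (hC₁.trans le_sup_left))
  have hglue (hxC : (complete (V₁ ∩ V₂) : GainGraph V G).IsProper x)
      (hyC : (complete (V₁ ∩ V₂) : GainGraph V G).IsProper y) :=
    isProper_sup_piecewise_iff (x := x) (y := y) h₁ h₂ (hφ _ _) fun a ha =>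
      hφC _ _ (isProper_complete_iff.1 hxC).injective (isProper_complete_iff.1 hyC).injective
        ⟨a, ha⟩
  rw [hy]
  exact ⟨fun h => ⟨(hglue (h.1.mono hC₁) (h.2.mono hC₂)).2 h, h.2.mono hC₂⟩,
    fun h => (hglue (hx _ h.1) h.2).1 h.1⟩

end Sup

/-! ### Reductions by contractions -/

section ContractsOnto

/-- Up to the factor of an isolated vertex, the numbers of proper colourings of `B` divide those
of `A`, with a quotient that is polynomial in the number of colours. -/
def CountDvd {V : Type u} {G : Type v} [AddCommGroup G] (A B : GainGraph V G) : Prop :=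
  ∃ q : ℤ[X], ∀ k ≥ Nat.card V, (Nat.card (Colour G k) : ℤ) * A.numProper k =
    q.eval (Nat.card (Colour G k) : ℤ) * B.numProper k

/-- `A` can be reduced to the complete gain graph on `W` by contractions of edges that do not
remove any vertex of `W` and divide the numbers of proper colourings. -/
inductive ContractsOnto {V : Type u} {G : Type v} [AddCommGroup G] (W : Set V) :
    GainGraph V G → Prop
  | complete : ContractsOnto W (complete W)
  | elim {A : GainGraph V G} {u v : V} {g : G} (hv : v ∉ W) (huv : A.Adj u v g)
      (hdvd : A.CountDvd (A.elim u v g)) (h : ContractsOnto W (A.elim u v g)) : ContractsOnto W A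

variable {V : Type u} {G : Type v} [AddCommGroup G]

theorem CountDvd.contract_equiv {A B : GainGraph V G} (h : A.CountDvd B) (σ : Equiv.Perm V)
    (p p' : V → G) : (A.contract σ p).CountDvd (B.contract σ p') := by
  simpa only [CountDvd, numProper_contract_equiv] using h

theorem ContractsOnto.contract_equiv {W : Set V} {A : GainGraph V G} (h : ContractsOnto W A)
    (σ : Equiv.Perm V) (p : V → G) : ContractsOnto (σ '' W) (A.contract σ p) := by
  induction h with
  | complete => exact contract_complete W σ p ▸ .complete
  | @elim A u v g hv huv hdvd _ ih =>
    have helim := A.elim_contract_equiv σ p u v g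
    refine .elim (u := σ u) (v := σ v) (g := g - p u + p v) ?_ ?_ ?_ (helim ▸ ih)
    · rwa [σ.injective.mem_set_image]
    · refine ⟨σ.injective.ne (A.ne_of_adj huv), u, v, rfl, rfl, ?_⟩
      convert huv using 1
      abel
    · exact helim ▸ hdvd.contract_equiv σ p p

theorem CountDvd.sup_elim [Finite V] [Finite G] {A₁ A₂ : GainGraph V G} {V₁ V₂ : Set V}
    (h₁ : A₁ ≤ complete V₁) (h₂ : A₂ ≤ complete V₂) (hC₁ : complete (V₁ ∩ V₂) ≤ A₁)
    (hC₂ : complete (V₁ ∩ V₂) ≤ A₂) {B₂ : GainGraph V G} (h₂' : B₂ ≤ complete V₂)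
    (hC₂' : complete (V₁ ∩ V₂) ≤ B₂) (h : A₂.CountDvd B₂) : (A₁ ⊔ A₂).CountDvd (A₁ ⊔ B₂) := by
  obtain ⟨q, hq⟩ := h
  refine ⟨q, fun k hk => ?_⟩
  have hpos := numProper_pos (complete (V₁ ∩ V₂) : GainGraph V G) hk
  have hA := numProper_sup_mul_numProper_complete h₁ h₂ hC₁ hC₂ k
  have hB := numProper_sup_mul_numProper_complete h₁ h₂' hC₁ hC₂' k
  apply mul_right_cancel₀ (b := ((complete (V₁ ∩ V₂) : GainGraph V G).numProper k : ℤ))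
    (by exact_mod_cast hpos.ne')
  zify at hA hB
  linear_combination (Nat.card (Colour G k) : ℤ) * hA + (A₁.numProper k : ℤ) * hq k hk -
    q.eval (Nat.card (Colour G k) : ℤ) * hB

theorem ContractsOnto.sup [Finite V] [Finite G] {W V₁ V₂ : Set V} {A₁ A₂ : GainGraph V G}
    (h₁ : A₁ ≤ GainGraph.complete V₁) (hC₁ : GainGraph.complete (V₁ ∩ V₂) ≤ A₁)
    (h₂ : A₂ ≤ GainGraph.complete V₂) (hC₂ : GainGraph.complete (V₁ ∩ V₂) ≤ A₂) (hW : W ∩ V₂ ⊆ V₁)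
    (hA₁ : ContractsOnto W A₁) (hA₂ : ContractsOnto (V₁ ∩ V₂) A₂) :
    ContractsOnto W (A₁ ⊔ A₂) := by
  induction hA₂ with
  | complete => rwa [sup_eq_left.2 hC₁]
  | @elim A₂ u v g hv huv hdvd _ ih =>
    obtain ⟨hu₂, hv₂, -⟩ := h₂ _ _ _ huv
    have hv₁ : v ∉ V₁ := fun h => hv ⟨h, hv₂⟩
    have h₂' : A₂.elim u v g ≤ GainGraph.complete V₂ := elim_le_complete h₂ hu₂ g
    have hC₂' : GainGraph.complete (V₁ ∩ V₂) ≤ A₂.elim u v g :=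
      (elim_eq_self le_rfl hv g).ge.trans (elim_mono hC₂ u v g)
    have helim : (A₁ ⊔ A₂).elim u v g = A₁ ⊔ A₂.elim u v g := by
      rw [elim_sup, elim_eq_self h₁ hv₁]
    refine .elim (fun h => hv₁ (hW ⟨h, hv₂⟩)) (Or.inr huv) ?_ (helim ▸ ih h₂' hC₂')
    exact helim ▸ hdvd.sup_elim h₁ h₂ hC₁ hC₂ h₂' hC₂'

end ContractsOnto

/-! ### Link-simplicial vertices and gluing -/

section Simplicial

variable {V : Type u} {G : Type v} [AddCommGroup G] {A : GainGraph V G} {v : V}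

/-- Link-simplicial vertices of a gain graph. -/
def IsSimplicial (A : GainGraph V G) (v : V) : Prop :=
  ∀ a b g h, a ≠ b → A.Adj a v g → A.Adj v b h → A.Adj a b (g + h)

/-- The colours which the edges at `v` forbid for `v`, once the other vertices are coloured by
`y`. -/
def forbidden (A : GainGraph V G) (v : V) {T : Type w} [VAdd G T] (y : V → T) : Set T :=
  {s | ∃ b h, A.Adj v b h ∧ s = h +ᵥ y b}

theorem IsSimplicial.ncard_forbidden (hv : A.IsSimplicial v) {T : Type w} [AddAction G T]
    [IsCancelVAdd G T] {y : V → T} (hy : (A.restrict {v}ᶜ).IsProper y) :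
    (A.forbidden v y).ncard = Nat.card {e : V × G // A.Adj v e.1 e.2} := by
  have hrange : A.forbidden v y =
      Set.range fun e : {e : V × G // A.Adj v e.1 e.2} => e.1.2 +ᵥ y e.1.1 := by
    ext s
    simp [forbidden, eq_comm]
  rw [hrange, ← Set.image_univ, Set.ncard_image_of_injective, Set.ncard_univ]
  rintro ⟨⟨b, h⟩, hb⟩ ⟨⟨b', h'⟩, hb'⟩ heq
  dsimp only at heq hb hb'
  obtain rfl : b = b' := by
    by_contra hbb
    refine hy b b' (-h + h') ⟨(A.ne_of_adj hb).symm, (A.ne_of_adj hb').symm,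
      hv b b' _ _ hbb (A.symm hb) hb'⟩ ?_
    rw [add_vadd, ← heq, neg_vadd_vadd]
  obtain rfl : h = h' := IsCancelVAdd.right_cancel _ _ _ heq
  rfl

theorem isProper_update_iff [DecidableEq V] {T : Type w} [AddAction G T] {y : V → T} {s : T} :
    A.IsProper (Function.update y v s) ↔
      (A.restrict {v}ᶜ).IsProper y ∧ s ∉ A.forbidden v y := by
  constructor
  · refine fun hx => ⟨fun a b h hab heq => hx a b h hab.2.2 ?_, ?_⟩
    · rwa [Function.update_of_ne hab.1, Function.update_of_ne hab.2.1]
    · rintro ⟨b, h, hb, rfl⟩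
      refine hx v b h hb ?_
      rw [Function.update_self, Function.update_of_ne (A.ne_of_adj hb).symm]
  · rintro ⟨hy, hs⟩ a b h hab heq
    have hne := A.ne_of_adj hab
    rcases eq_or_ne a v with rfl | ha
    · rw [Function.update_self, Function.update_of_ne hne.symm] at heq
      exact hs ⟨b, h, hab, heq⟩
    rcases eq_or_ne b v with rfl | hb
    · rw [Function.update_self, Function.update_of_ne ha] at heq
      exact hs ⟨a, -h, A.symm hab, by rw [heq, neg_vadd_vadd]⟩
    · rw [Function.update_of_ne ha, Function.update_of_ne hb] at heq
      exact hy a b h ⟨ha, hb, hab⟩ heq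

open Classical in
/-- A proper colouring together with a colour `c` for the vertex `v`, isolated in
`A.restrict {v}ᶜ`, amounts to a proper colouring of `A.restrict {v}ᶜ` with value `c` at `v` and an
allowed colour for `v`. -/
noncomputable def properEquivSigma (A : GainGraph V G) (v : V) (T : Type w) [AddAction G T] :
    {x : V → T // A.IsProper x} × T ≃
      Σ y : {y : V → T // (A.restrict {v}ᶜ).IsProper y}, ((A.forbidden v y.1)ᶜ : Set T) where
  toFun q :=
    have h := isProper_update_iff (v := v) (y := Function.update q.1.1 v q.2) (s := q.1.1 v) |>.1
      (by simpa using q.1.2)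
    ⟨⟨Function.update q.1.1 v q.2, h.1⟩, ⟨q.1.1 v, h.2⟩⟩
  invFun q := (⟨Function.update q.1.1 v q.2.1, isProper_update_iff.2 ⟨q.1.2, q.2.2⟩⟩, q.1.1 v)
  left_inv q := Prod.ext (Subtype.ext (by simp)) (by simp)
  right_inv q := Sigma.subtype_ext (Subtype.ext (by simp)) (by simp)

theorem IsSimplicial.mul_numProper [Finite V] [Finite G] (hv : A.IsSimplicial v) (k : ℕ) :
    (Nat.card (Colour G k) : ℤ) * A.numProper k =
      (Nat.card (Colour G k) - Nat.card {e : V × G // A.Adj v e.1 e.2}) *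
        (A.restrict {v}ᶜ).numProper k := by
  have hallowed (y : {y : V → Colour G k // (A.restrict {v}ᶜ).IsProper y}) :
      (Nat.card ((A.forbidden v y.1)ᶜ : Set (Colour G k)) : ℤ) =
        Nat.card (Colour G k) - Nat.card {e : V × G // A.Adj v e.1 e.2} := by
    rw [← hv.ncard_forbidden y.2, Nat.card_coe_set_eq, eq_sub_iff_add_eq']
    exact_mod_cast Set.ncard_add_ncard_compl _
  have := Fintype.ofFinite {y : V → Colour G k // (A.restrict {v}ᶜ).IsProper y}
  have hcard := congrArg (Nat.cast (R := ℤ)) (Nat.card_congr (properEquivSigma A v (Colour G k)))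
  rw [Nat.card_prod, Nat.card_sigma, Nat.cast_mul, Nat.cast_sum,
    Finset.sum_congr rfl fun y _ => hallowed y, Finset.sum_const, Finset.card_univ,
    ← Nat.card_eq_fintype_card, nsmul_eq_mul] at hcard
  unfold numProper
  linear_combination hcard

theorem IsSimplicial.countDvd [Finite V] [Finite G] (hv : A.IsSimplicial v) :
    A.CountDvd (A.restrict {v}ᶜ) :=
  ⟨X - C (Nat.card {e : V × G // A.Adj v e.1 e.2} : ℤ), fun k _ => by
    rw [hv.mul_numProper k, eval_sub, eval_X, eval_C]⟩

theorem IsSimplicial.elim_eq_restrict (hv : A.IsSimplicial v) {u : V} {g : G}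
    (hu : A.Adj u v g) : A.elim u v g = A.restrict {v}ᶜ := by
  classical
  have huv := A.ne_of_adj hu
  refine le_antisymm ?_ ((elim_eq_self restrict_le_complete (by simp) g).ge.trans
    (elim_mono restrict_le_self u v g))
  rintro _ _ h ⟨hab, c, d, rfl, rfl, hA⟩
  have hmem (c : V) : Function.update id v u c ∈ ({v}ᶜ : Set V) := by
    by_cases hc : c = v <;> simp [hc, huv]
  refine ⟨hmem c, hmem d, ?_⟩
  rcases eq_or_ne c v with rfl | hc
  · have hd : d ≠ c := (A.ne_of_adj hA).symm
    simp only [Function.update_self, Function.update_of_ne hd, Pi.single_eq_same,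
      Pi.single_eq_of_ne hd, id] at hA hab ⊢
    convert hv u d _ _ hab hu hA using 1
    abel
  rcases eq_or_ne d v with rfl | hd
  · simp only [Function.update_self, Function.update_of_ne hc, Pi.single_eq_same,
      Pi.single_eq_of_ne hc, id] at hA hab ⊢
    convert hv c u _ _ hab hA (A.symm hu) using 1
    abel
  · simpa [hc, hd] using hA

theorem IsSimplicial.contractsOnto_of_notMem [Finite V] [Finite G] (hv : A.IsSimplicial v)
    {W : Set V} (hvW : v ∉ W) (h : ContractsOnto W (A.restrict {v}ᶜ)) : ContractsOnto W A := by
  by_cases hN : ∃ u g, A.Adj u v g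
  · obtain ⟨u, g, hu⟩ := hN
    have helim := hv.elim_eq_restrict hu
    exact .elim hvW hu (helim ▸ hv.countDvd) (helim ▸ h)
  · push Not at hN
    have hle : A ≤ A.restrict {v}ᶜ := fun a b g hab => by
      refine ⟨?_, ?_, hab⟩ <;> rintro rfl
      exacts [hN _ _ (A.symm hab), hN _ _ hab]
    rwa [← restrict_le_self.antisymm hle]

theorem IsSimplicial.contractsOnto_of_adj [Finite V] [Finite G] (hv : A.IsSimplicial v)
    {W : Set V} (hvW : v ∈ W) (hW : complete W ≤ A) {u : V} {g : G} (hu : A.Adj u v g)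
    (huW : u ∉ W)
    (h : ∀ W : Set V, complete W ≤ A.restrict {v}ᶜ → ContractsOnto W (A.restrict {v}ᶜ)) :
    ContractsOnto W A := by
  classical
  have huv := A.ne_of_adj hu
  have hclique : complete (insert u (W \ {v})) ≤ A.restrict {v}ᶜ := by
    have huw {w : V} (hw : w ∈ W \ {v}) (h : G) : A.Adj u w h := by
      simpa using hv u w g (-g + h) (fun e => huW (e ▸ hw.1)) hu
        (hW v w _ ⟨hvW, hw.1, fun e => hw.2 e.symm⟩)
    refine le_restrict (complete_mono ?_) ?_
    · rintro a (rfl | ha)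
      exacts [huv, ha.2]
    · rintro a b h ⟨rfl | ha, rfl | hb, hab⟩
      exacts [absurd rfl hab, huw hb h, neg_neg h ▸ A.symm (huw ha (-h)),
        hW a b h ⟨ha.1, hb.1, hab⟩]
  have helim : A.elim v u (-g) = (A.restrict {v}ᶜ).contract (Equiv.swap u v) (Pi.single u g) := by
    rw [elim_symm A huv g, hv.elim_eq_restrict hu]
  have himage : Equiv.swap u v '' insert u (W \ {v}) = W := by
    rw [Equiv.image_eq_preimage_symm]
    ext a
    rcases eq_or_ne a u with rfl | hau
    · simp [huW, huv.symm]
    rcases eq_or_ne a v with rfl | hav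
    · simp [hvW]
    · simp [Equiv.swap_apply_of_ne_of_ne hau hav, hau, hav]
  refine .elim huW (A.symm hu) ?_ ?_ <;> rw [helim]
  · simpa only [CountDvd, numProper_contract_equiv] using hv.countDvd
  · exact himage ▸ (h _ hclique).contract_equiv _ _

theorem IsSimplicial.contractsOnto [Finite V] [Finite G] (hv : A.IsSimplicial v) {W : Set V}
    (hW : complete W ≤ A)
    (h : ∀ W : Set V, complete W ≤ A.restrict {v}ᶜ → ContractsOnto W (A.restrict {v}ᶜ)) :
    ContractsOnto W A := by
  by_cases hvW : v ∈ W
  swap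
  · refine hv.contractsOnto_of_notMem hvW (h W (le_restrict (complete_mono ?_) hW))
    rintro _ ha rfl
    exact hvW ha
  by_cases hN : ∃ u g, A.Adj u v g ∧ u ∉ W
  · obtain ⟨u, g, hu, huW⟩ := hN
    exact hv.contractsOnto_of_adj hvW hW hu huW h
  push Not at hN
  have hA : complete W ⊔ A.restrict {v}ᶜ = A := by
    refine le_antisymm (sup_le hW restrict_le_self) fun a b g hab => ?_
    rcases eq_or_ne a v with rfl | ha
    · exact Or.inl ⟨hvW, hN b _ (A.symm hab), A.ne_of_adj hab⟩
    rcases eq_or_ne b v with rfl | hb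
    · exact Or.inl ⟨hN a _ hab, hvW, A.ne_of_adj hab⟩
    · exact Or.inr ⟨ha, hb, hab⟩
  have hC : complete (W ∩ {v}ᶜ) ≤ A.restrict {v}ᶜ :=
    le_restrict (complete_mono Set.inter_subset_right)
      ((complete_mono Set.inter_subset_left).trans hW)
  exact hA ▸ ContractsOnto.sup le_rfl (complete_mono Set.inter_subset_left) restrict_le_complete hC
    Set.inter_subset_left .complete (h _ hC)

end Simplicial

section Relabel

variable {V : Type u} {V' : Type v} {G : Type w} [AddCommGroup G] {A : GainGraph V G} {f : V → V'}

theorem contract_zero_adj (hf : Function.Injective f) {a b : V'} {g : G} :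
    (A.contract f 0).Adj a b g ↔ ∃ c d, f c = a ∧ f d = b ∧ A.Adj c d g := by
  simp only [contract_adj, Pi.zero_apply, add_zero, sub_zero]
  refine and_iff_right_of_imp ?_
  rintro ⟨c, d, rfl, rfl, h⟩
  exact hf.ne (A.ne_of_adj h)

theorem contract_zero_apply_adj (hf : Function.Injective f) {c d : V} {g : G} :
    (A.contract f 0).Adj (f c) (f d) g ↔ A.Adj c d g := by
  rw [contract_zero_adj hf]
  refine ⟨?_, fun h => ⟨c, d, rfl, rfl, h⟩⟩
  rintro ⟨c', d', hc, hd, h⟩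
  rwa [← hf hc, ← hf hd]

theorem IsSimplicial.contract_zero (hf : Function.Injective f) {v : V} (hv : A.IsSimplicial v) :
    (A.contract f 0).IsSimplicial (f v) := by
  intro a b g h hab hav hvb
  obtain ⟨c, -, rfl, -, -⟩ := (contract_zero_adj hf).1 hav
  obtain ⟨-, d, -, rfl, -⟩ := (contract_zero_adj hf).1 hvb
  rw [contract_zero_apply_adj hf] at hav hvb ⊢
  exact hv c d g h (fun e => hab (congrArg f e)) hav hvb

end Relabel

section Glue

variable {V : Type u} {G : Type v} [AddCommGroup G] {A : GainGraph V G} {V₁ V₂ W : Set V}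

theorem inter_subset_or_of_complete_le (hA : A ≤ A.restrict V₁ ⊔ A.restrict V₂)
    (hW : complete W ≤ A) : W ∩ V₂ ⊆ V₁ ∨ W ∩ V₁ ⊆ V₂ := by
  by_contra! h
  obtain ⟨⟨a, ⟨ha, ha₂⟩, ha₁⟩, b, ⟨hb, _⟩, hb₂⟩ := h.imp Set.not_subset.1 Set.not_subset.1
  have hab : a ≠ b := fun e => hb₂ (e ▸ ha₂)
  rcases hA a b 0 (hW a b 0 ⟨ha, hb, hab⟩) with h | h
  exacts [ha₁ h.1, hb₂ h.2.1]

theorem contractsOnto_of_glue [Finite V] [Finite G] (hA : A ≤ A.restrict V₁ ⊔ A.restrict V₂)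
    (hC : complete (V₁ ∩ V₂) ≤ A) (hW : complete W ≤ A) (hWV : W ∩ V₂ ⊆ V₁)
    (h₁ : ∀ W : Set V, complete W ≤ A.restrict V₁ → ContractsOnto W (A.restrict V₁))
    (h₂ : ∀ W : Set V, complete W ≤ A.restrict V₂ → ContractsOnto W (A.restrict V₂)) :
    ContractsOnto W A := by
  have hC₁ := le_restrict (complete_mono Set.inter_subset_left) hC
  have hC₂ := le_restrict (complete_mono Set.inter_subset_right) hC
  have hW₁ : complete W ≤ A.restrict V₁ := fun a b g hab => by
    rcases hA a b g (hW a b g hab) with h | h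
    exacts [h, ⟨hWV ⟨hab.1, h.1⟩, hWV ⟨hab.2.1, h.2.1⟩, h.2.2⟩]
  rw [hA.antisymm (sup_le restrict_le_self restrict_le_self)]
  exact .sup restrict_le_complete hC₁ restrict_le_complete hC₂ hWV (h₁ W hW₁) (h₂ _ hC₂)

end Glue

end GainGraph

namespace LooplessGainGraph

open GainGraph (ContractsOnto)

variable {G : Type v}

/-- The gain graph on the vertex set of `Γ` with the same edges. -/
def toGainGraph [AddGroup G] (Γ : LooplessGainGraph.{u} G) : GainGraph Γ.V G where
  Adj := Γ.Adj
  symm := Γ.symm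
  ne_of_adj := Γ.ne_of_adj

variable [AddCommGroup G] {V : Type w}

/-- The inclusion of the vertices of an induced subgraph. -/
def inclusion (Γ : LooplessGainGraph.{u} G) (S : Set Γ.V) : (Γ.induce S).V → Γ.V :=
  Subtype.val

theorem inclusion_injective (Γ : LooplessGainGraph.{u} G) (S : Set Γ.V) :
    Function.Injective (Γ.inclusion S) :=
  Subtype.val_injective

theorem toGainGraph_induce_contract {Γ : LooplessGainGraph.{u} G} {f : Γ.V → V}
    (hf : Function.Injective f) {S : Set Γ.V} {T : Set V} (hT : f ⁻¹' T = S) :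
    (Γ.induce S).toGainGraph.contract (f ∘ Γ.inclusion S) 0 =
      (Γ.toGainGraph.contract f 0).restrict T := by
  subst hT
  ext a b g
  rw [GainGraph.contract_zero_adj (hf.comp (Γ.inclusion_injective _))]
  constructor
  · rintro ⟨c, d, rfl, rfl, h⟩
    exact ⟨c.2, d.2, (GainGraph.contract_zero_apply_adj hf).2 h⟩
  · rintro ⟨ha, hb, h⟩
    obtain ⟨c, d, rfl, rfl, hcd⟩ := (GainGraph.contract_zero_adj hf).1 h
    exact ⟨⟨c, ha⟩, ⟨d, hb⟩, rfl, rfl, hcd⟩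

theorem complete_image_le_of_iso [Finite G] {Γ : LooplessGainGraph.{u} G} {f : Γ.V → V}
    (hf : Function.Injective f) {S : Set Γ.V} {n : ℕ} (e : Iso (Γ.induce S) (complete G n)) :
    GainGraph.complete (f '' S) ≤ Γ.toGainGraph.contract f 0 := by
  rintro _ _ g ⟨⟨c, hc, rfl⟩, ⟨d, hd, rfl⟩, hcd⟩
  refine (GainGraph.contract_zero_apply_adj hf).2 ((e.adj_iff ⟨c, hc⟩ ⟨d, hd⟩ g).1 fun h => ?_)
  exact hcd (congrArg (f ∘ Subtype.val) (e.toEquiv.injective h))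

theorem ExtendedLiftClass.contractsOnto [Finite G] [Finite V] {Γ : LooplessGainGraph.{u} G}
    (hΓ : ExtendedLiftClass G Γ) {f : Γ.V → V} (hf : Function.Injective f) {W : Set V}
    (hW : GainGraph.complete W ≤ Γ.toGainGraph.contract f 0) :
    ContractsOnto W (Γ.toGainGraph.contract f 0) := by
  induction hΓ generalizing W with
  | null Γ hΓ =>
    have hle : Γ.toGainGraph.contract f 0 ≤ GainGraph.complete W :=
      fun _ _ _ ⟨_, c, _⟩ => hΓ.elim c
    exact hle.antisymm hW ▸ .complete
  | linkSimplicial Γ v hv _ ih =>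
    have hv' : Γ.toGainGraph.IsSimplicial v := hv
    have hT : f ⁻¹' {f v}ᶜ = {v}ᶜ := by
      ext a
      simp [hf.eq_iff]
    refine (hv'.contract_zero hf).contractsOnto hW fun W => ?_
    rw [← toGainGraph_induce_contract hf hT]
    exact ih (hf.comp (Γ.inclusion_injective _))
  | glue Γ V₁ V₂ _ _ _ hE n hn ih₁ ih₂ =>
    have ih₁' (W) := ih₁ (hf.comp (Γ.inclusion_injective V₁)) (W := W)
    have ih₂' (W) := ih₂ (hf.comp (Γ.inclusion_injective V₂)) (W := W)
    rw [toGainGraph_induce_contract hf (hf.preimage_image _)] at ih₁' ih₂'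
    obtain ⟨e⟩ := hn
    have hC := complete_image_le_of_iso hf e
    rw [Set.image_inter hf] at hC
    have hA : Γ.toGainGraph.contract f 0 ≤ (Γ.toGainGraph.contract f 0).restrict (f '' V₁) ⊔
        (Γ.toGainGraph.contract f 0).restrict (f '' V₂) := by
      intro _ _ g h
      obtain ⟨c, d, rfl, rfl, hcd⟩ := (GainGraph.contract_zero_adj hf).1 h
      exact (hE c d g hcd).imp (fun hV => ⟨⟨c, hV.1, rfl⟩, ⟨d, hV.2, rfl⟩, h⟩)
        fun hV => ⟨⟨c, hV.1, rfl⟩, ⟨d, hV.2, rfl⟩, h⟩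
    rcases GainGraph.inter_subset_or_of_complete_le hA hW with hWV | hWV
    · exact GainGraph.contractsOnto_of_glue hA hC hW hWV ih₁' ih₂'
    · rw [sup_comm] at hA
      rw [Set.inter_comm] at hC
      exact GainGraph.contractsOnto_of_glue hA hC hW hWV ih₂' ih₁'

end LooplessGainGraph

/-! ### The intersection lattice of `A_+(Γ)` and its points -/

section BlockSubmodule

variable {K : Type v} [Field K] {G : AddSubgroup K} {V : Type u} {ι : Type w}

/-- The subspace of `K ^ (n + 1)` on which all the differences of coordinates inside a fibre of `f`
are the multiples of `z` prescribed by the potential `p`. -/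
def blockSubmodule (f : V → ι) (p : V → G) : Submodule K (Option V → K) where
  carrier := {y | ∀ a b, f a = f b → y (some a) - y (some b) = (p a - p b) * y none}
  add_mem' {y y'} hy hy' a b hab := by
    simp only [Pi.add_apply]
    linear_combination hy a b hab + hy' a b hab
  zero_mem' a b _ := by simp
  smul_mem' c y hy a b hab := by
    simp only [Pi.smul_apply, smul_eq_mul]
    linear_combination c * hy a b hab

theorem mem_blockSubmodule {f : V → ι} {p : V → G} {y : Option V → K} :
    y ∈ blockSubmodule f p ↔
      ∀ a b, f a = f b → y (some a) - y (some b) = (p a - p b) * y none :=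
  Iff.rfl

theorem le_blockSubmodule_iff {f : V → ι} {p : V → G} {P : Submodule K (Option V → K)} :
    P ≤ blockSubmodule f p ↔ ∀ a b, f a = f b → P ≤ edgeHyperplane a b ((p a - p b : G) : K) := by
  simp only [SetLike.le_def, mem_blockSubmodule, mem_edgeHyperplane, AddSubgroup.coe_sub]
  exact ⟨fun h a b hab y hy => h hy a b hab, fun h y hy a b hab => h a b hab hy⟩

theorem le_blockSubmodule_quot_iff {r : V → V → Prop} {p : V → G}
    {P : Submodule K (Option V → K)} :
    P ≤ blockSubmodule (Quot.mk r) p ↔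
      ∀ a b, r a b → P ≤ edgeHyperplane a b ((p a - p b : G) : K) := by
  rw [le_blockSubmodule_iff]
  refine ⟨fun h a b hab => h a b (Quot.sound hab), fun h a b hab y hy => ?_⟩
  have hlift : ∀ c d, r c d → y (some c) - p c * y none = y (some d) - p d * y none := by
    intro c d hcd
    have := (mem_edgeHyperplane _ _ _ _).1 (h c d hcd hy)
    push_cast at this
    linear_combination this
  have hquot : y (some a) - p a * y none = y (some b) - p b * y none :=
    congrArg (Quot.lift (fun c => y (some c) - p c * y none) hlift) hab
  rw [mem_edgeHyperplane, AddSubgroup.coe_sub]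
  linear_combination hquot

/-- The parametrization of `blockSubmodule f p` by the coordinate `z` and one translation for each
fibre of `f`. -/
def blockMap (f : V → ι) (p : V → G) : K × (ι → K) →ₗ[K] (Option V → K) where
  toFun c o := o.elim c.1 fun a => c.2 (f a) + p a * c.1
  map_add' c c' := by
    ext (_ | a)
    · rfl
    · simp only [Option.elim, Prod.snd_add, Pi.add_apply, Prod.fst_add]
      ring
  map_smul' s c := by
    ext (_ | a)
    · rfl
    · simp only [Option.elim, Prod.smul_snd, Pi.smul_apply, Prod.smul_fst, smul_eq_mul,
        RingHom.id_apply]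
      ring

@[simp] theorem blockMap_none (f : V → ι) (p : V → G) (c : K × (ι → K)) :
    blockMap f p c none = c.1 := rfl

@[simp] theorem blockMap_some (f : V → ι) (p : V → G) (c : K × (ι → K)) (a : V) :
    blockMap f p c (some a) = c.2 (f a) + p a * c.1 := rfl

theorem range_blockMap (f : V → ι) (p : V → G) :
    LinearMap.range (blockMap f p) = blockSubmodule f p := by
  refine le_antisymm ?_ fun y hy => ?_
  · rintro _ ⟨c, rfl⟩ a b hab
    simp only [blockMap_some, blockMap_none, hab]
    ring
  · have hfactor : Function.FactorsThrough (fun a => y (some a) - p a * y none) f :=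
      fun a b hab => by linear_combination hy a b hab
    refine ⟨(y none, Function.extend f (fun a => y (some a) - p a * y none) 0), ?_⟩
    ext (_ | a) <;> simp [hfactor.extend_apply]

theorem blockMap_mem (f : V → ι) (p : V → G) (c : K × (ι → K)) :
    blockMap f p c ∈ blockSubmodule f p :=
  range_blockMap f p ▸ LinearMap.mem_range_self _ c

theorem not_blockSubmodule_le_hyperplaneAtInfinity (f : V → ι) (p : V → G) :
    ¬ blockSubmodule f p ≤ hyperplaneAtInfinity K V := fun h => by
  simpa [mem_hyperplaneAtInfinity] using h (blockMap_mem f p (1, 0))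

theorem inf_blockSubmodule_le_edgeHyperplane_iff {f : V → ι} {p : V → G} {a b : V} {h : K} :
    hyperplaneAtInfinity K V ⊓ blockSubmodule f p ≤ edgeHyperplane a b h ↔ f a = f b := by
  classical
  constructor
  · intro hle
    have hmem := hle ⟨(mem_hyperplaneAtInfinity _).2 rfl, blockMap_mem f p (0, Pi.single (f a) 1)⟩
    by_contra hab
    simp [mem_edgeHyperplane, Ne.symm hab] at hmem
  · rintro hab y ⟨hy₀, hy⟩
    rw [SetLike.mem_coe, mem_hyperplaneAtInfinity] at hy₀
    rw [mem_edgeHyperplane, mem_blockSubmodule.1 hy a b hab, hy₀, mul_zero, mul_zero]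

theorem blockSubmodule_le_edgeHyperplane_iff {f : V → ι} {p : V → G} {a b : V} {h : G} :
    blockSubmodule f p ≤ edgeHyperplane a b (h : K) ↔ f a = f b ∧ p a - p b = h := by
  constructor
  · intro hle
    refine ⟨inf_blockSubmodule_le_edgeHyperplane_iff.1 (inf_le_right.trans hle), Subtype.ext ?_⟩
    simpa [mem_edgeHyperplane] using hle (blockMap_mem f p (1, 0))
  · rintro ⟨hab, rfl⟩
    exact le_blockSubmodule_iff.1 le_rfl a b hab

variable [Finite V]

theorem finrank_blockSubmodule (f : V → ι) (p : V → G) :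
    Module.finrank K (blockSubmodule f p) = (Set.range f).ncard + 1 := by
  have hf : blockSubmodule f p = blockSubmodule (Set.rangeFactorization f) p :=
    Submodule.ext fun y => by
      simp only [mem_blockSubmodule, Set.rangeFactorization, Subtype.ext_iff]
  have hinj : Function.Injective (blockMap (Set.rangeFactorization f) p) := by
    intro c c' h
    have h₀ : c.1 = c'.1 := congrFun h none
    refine Prod.ext h₀ (funext fun j => ?_)
    obtain ⟨a, rfl⟩ := Set.rangeFactorization_surjective j
    have ha : c.2 _ + p a * c.1 = c'.2 _ + p a * c'.1 := congrFun h (some a)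
    rwa [h₀, add_left_inj] at ha
  have := Fintype.ofFinite (Set.range f)
  rw [hf, ← range_blockMap, LinearMap.finrank_range_of_inj hinj, Module.finrank_prod,
    Module.finrank_self, Module.finrank_fintype_fun_eq_card, ← Nat.card_eq_fintype_card,
    Nat.card_coe_set_eq, add_comm]

theorem finrank_inf_blockSubmodule (f : V → ι) (p : V → G) :
    Module.finrank K ↥(hyperplaneAtInfinity K V ⊓ blockSubmodule f p) =
      (Set.range f).ncard := by
  have hcodim : Module.finrank K ((Option V → K) ⧸ hyperplaneAtInfinity K V) = 1 := by
    classical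
    refine codim_ker_eq_one _ fun h => ?_
    simpa using LinearMap.congr_fun h (Pi.single none 1)
  have hle := codim_inf_le (P := blockSubmodule f p) hcodim
  have hlt := codim_inf_lt (not_blockSubmodule_le_hyperplaneAtInfinity f p)
  have h₁ := (blockSubmodule f p).finrank_quotient_add_finrank
  have h₂ := (hyperplaneAtInfinity K V ⊓ blockSubmodule f p).finrank_quotient_add_finrank
  have h₃ := finrank_blockSubmodule f p
  omega

end BlockSubmodule

section Points

variable {K : Type v} [Field K] {G : AddSubgroup K} {V : Type u} {ι : Type w} {k : ℕ}

/-- The subspace of a colouring `x` considered as a point outside `{z = 0}`. For `k = 1` it is the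
line spanned by the point `(1, x)`; in general `Fin k` stands for the cosets of `G` in a larger
field, and the subspace is cut out by the equations that hold between vertices with colours in the
same coset. -/
def finitePoint (x : V → Colour G k) : Submodule K (Option V → K) :=
  blockSubmodule (fun a => (x a).2) fun a => (x a).1

/-- The subspace of a colouring `x` considered as a point of `{z = 0}`. -/
def infinitePoint (x : V → Colour G k) : Submodule K (Option V → K) :=
  hyperplaneAtInfinity K V ⊓ blockSubmodule x (0 : V → G)

theorem finitePoint_le_edgeHyperplane_iff {x : V → Colour G k} {a b : V} {h : G} :
    finitePoint x ≤ edgeHyperplane a b (h : K) ↔ x a = h +ᵥ x b := by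
  rw [finitePoint, blockSubmodule_le_edgeHyperplane_iff, Colour.eq_vadd_iff, sub_eq_iff_eq_add,
    and_comm]

theorem finitePoint_le_blockSubmodule_iff {x : V → Colour G k} {f : V → ι} {p : V → G} :
    finitePoint x ≤ blockSubmodule f p ↔ Function.FactorsThrough (fun a => -p a +ᵥ x a) f := by
  rw [le_blockSubmodule_iff]
  refine forall₃_congr fun _ _ _ => ?_
  rw [finitePoint_le_edgeHyperplane_iff, neg_vadd_eq_iff, vadd_vadd, sub_eq_add_neg]

theorem infinitePoint_le_blockSubmodule_iff {x : V → Colour G k} {f : V → ι} {p : V → G} :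
    infinitePoint x ≤ blockSubmodule f p ↔ Function.FactorsThrough x f := by
  simp only [le_blockSubmodule_iff, infinitePoint, inf_blockSubmodule_le_edgeHyperplane_iff]
  rfl

/-- Functions that factor through `f` are functions on the range of `f`. -/
noncomputable def factorsThroughEquiv (f : V → ι) (T : Type*) :
    {x : V → T // Function.FactorsThrough x f} ≃ (Set.range f → T) where
  toFun x j := x.1 j.2.choose
  invFun y := ⟨y ∘ Set.rangeFactorization f, fun _ _ hab => congrArg y (Subtype.ext hab)⟩
  left_inv x := Subtype.ext (funext fun a => x.2 (Set.mem_range_self a).choose_spec)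
  right_inv y := funext fun j => congrArg y (Subtype.ext j.2.choose_spec)

variable [Finite V]

theorem card_infinitePoint_le_blockSubmodule (f : V → ι) (p : V → G) (k : ℕ) :
    Nat.card {x : V → Colour G k // infinitePoint x ≤ blockSubmodule f p} =
      Nat.card (Colour G k) ^ (Set.range f).ncard := by
  simp only [infinitePoint_le_blockSubmodule_iff]
  rw [Nat.card_congr (factorsThroughEquiv f _), Nat.card_fun, Nat.card_coe_set_eq]

theorem card_finitePoint_le_blockSubmodule (f : V → ι) (p : V → G) (k : ℕ) :
    Nat.card {x : V → Colour G k // finitePoint x ≤ blockSubmodule f p} =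
      Nat.card (Colour G k) ^ (Set.range f).ncard := by
  rw [← card_infinitePoint_le_blockSubmodule f p]
  let e : (V → Colour G k) ≃ (V → Colour G k) :=
    Equiv.piCongrRight fun a => AddAction.toPerm (-p a)
  refine Nat.card_congr (e.subtypeEquiv fun x => ?_)
  rw [finitePoint_le_blockSubmodule_iff, infinitePoint_le_blockSubmodule_iff]
  rfl

end Points

theorem sum_filter_sumElim {α : Type u} {β : Type v} [Fintype α] [Fintype β] (a b : ℤ)
    (p : α ⊕ β → Prop) [DecidablePred p] :
    ∑ ω with p ω, Sum.elim (fun _ => a) (fun _ => b) ω =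
      a * Nat.card {x // p (.inl x)} + b * Nat.card {y // p (.inr y)} := by
  simp only [Finset.sum_filter, Fintype.sum_sum_type, Sum.elim_inl, Sum.elim_inr,
    Nat.card_eq_fintype_card, Fintype.card_subtype]
  simp only [← Finset.sum_filter, Finset.sum_const, nsmul_eq_mul, mul_comm]

theorem exists_potential {V : Type u} {K : Type v} [AddCommGroup K] {G : AddSubgroup K}
    (r : V → V → Prop) (q : V → K) (hq : ∀ a b, r a b → q a - q b ∈ G) :
    ∃ p : V → G, ∀ a b, r a b → (p a : K) - p b = q a - q b := by
  let base (a : V) : V := (Quot.mk r a).out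
  have hbase (a : V) : (q (base a) : K ⧸ G) = q a :=
    congrArg (Quot.lift (fun c => (q c : K ⧸ G)) fun c d hcd =>
      QuotientAddGroup.eq_iff_sub_mem.2 (hq c d hcd)) (Quot.out_eq (Quot.mk r a))
  refine ⟨fun a => ⟨q a - q (base a), QuotientAddGroup.eq_iff_sub_mem.1 (hbase a).symm⟩,
    fun a b hab => ?_⟩
  have hab' : base a = base b := congrArg Quot.out (Quot.sound hab)
  simp only [hab', sub_sub_sub_cancel_right]

theorem card_subtype_comp {V : Type u} {ι : Type v} [Finite ι] (f : V → ι) {T : Type w}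
    (Q : (V → T) → Prop) :
    Nat.card {y : ι → T // Q (y ∘ f)} =
      Nat.card {x : V → T // Function.FactorsThrough x f ∧ Q x} *
        Nat.card T ^ (Set.range f)ᶜ.ncard := by
  classical
  let e : (ι → T) ≃ {x : V → T // Function.FactorsThrough x f} × (↥(Set.range f)ᶜ → T) :=
    (Equiv.piEquivPiSubtypeProd (· ∈ Set.range f) fun _ => T).trans
      ((factorsThroughEquiv f T).symm.prodCongr (.refl _))
  rw [Nat.card_congr (e.subtypeEquiv (p := fun y => Q (y ∘ f)) (q := fun z => Q z.1.1)
      fun _ => Iff.rfl),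
    Nat.card_congr (Equiv.prodSubtypeFstEquivSubtypeProd
      (p := fun x : {x : V → T // Function.FactorsThrough x f} => Q x.1)),
    Nat.card_prod, Nat.card_fun, Nat.card_coe_set_eq,
    Nat.card_congr (Equiv.subtypeSubtypeEquivSubtypeInter _ Q)]

open Classical in
theorem inf_edgeHyperplane_le_blockSubmodule {K : Type v} [Field K] {G : AddSubgroup K}
    {V : Type u} {ι : Type w} (f : V → ι) (p : V → G) (c d : V) (g : G) :
    blockSubmodule f p ⊓ edgeHyperplane c d ((g + p c - p d : G) : K) ≤
      blockSubmodule (Function.update id (f d) (f c) ∘ f)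
        fun a => p a + (Pi.single (f d) (-g) : ι → G) (f a) := by
  rintro y ⟨hy, hcd⟩ a b hab
  have hy (a b : V) (hab : f a = f b) := mem_blockSubmodule.1 hy a b hab
  rw [SetLike.mem_coe, mem_edgeHyperplane] at hcd
  push_cast at hcd
  by_cases ha : f a = f d <;> by_cases hb : f b = f d <;>
    simp only [Function.comp_apply, ha, hb, Function.update_self, ne_eq, not_false_eq_true,
      Function.update_of_ne, id_eq, Pi.single_eq_same, Pi.single_eq_of_ne, add_zero] at hab ⊢ <;>
    push_cast
  · linear_combination hy a b (ha.trans hb.symm)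
  · linear_combination hy a d ha + hy c b hab - hcd
  · linear_combination hy a c hab - hy b d hb + hcd
  · linear_combination hy a b hab

theorem ncard_compl_range_update_comp {V : Type u} {ι : Type v} [DecidableEq ι] [Finite ι]
    (f : V → ι) {c d : V} (hcd : f c ≠ f d) :
    (Set.range (Function.update id (f d) (f c) ∘ f))ᶜ.ncard = (Set.range f)ᶜ.ncard + 1 := by
  have hrange : (Set.range (Function.update id (f d) (f c) ∘ f))ᶜ =
      insert (f d) (Set.range f)ᶜ := by
    ext i
    simp only [Set.mem_compl_iff, Set.mem_range, Function.comp_apply, Set.mem_insert_iff,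
      Function.update_apply, id]
    grind
  rw [hrange, Set.ncard_insert_of_notMem (Set.notMem_compl_iff.2 (Set.mem_range_self d))]

/-! ### Contractions of `M(A_+(Γ))` -/

namespace LooplessGainGraph

section Points

variable {K : Type v} [Field K] {G : AddSubgroup K} (Γ : LooplessGainGraph.{u} G)

theorem exists_sInf_eq {F : Set (Submodule K (Option Γ.V → K))}
    (hF : F ⊆ Γ.extendedLiftArrangement.carrier) :
    ∃ (ι : Type u) (f : Γ.V → ι) (p : Γ.V → G),
      sInf F = hyperplaneAtInfinity K Γ.V ⊓ blockSubmodule f p ∨ sInf F = blockSubmodule f p := by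
  let r (a b : Γ.V) : Prop := ∃ h : G, edgeHyperplane a b (h : K) ∈ F
  refine ⟨Quot r, Quot.mk r, ?_⟩
  by_cases hinf : sInf F ≤ hyperplaneAtInfinity K Γ.V
  · refine ⟨0, .inl (le_antisymm (le_inf hinf ?_) (le_sInf fun H hH => ?_))⟩
    · refine le_blockSubmodule_quot_iff.2 fun a b ⟨h, hab⟩ y hy => ?_
      have hy₀ := (mem_hyperplaneAtInfinity y).1 (hinf hy)
      have hy₁ := (mem_edgeHyperplane _ _ _ y).1 (sInf_le hab hy)
      rw [mem_edgeHyperplane, hy₁, hy₀, mul_zero, mul_zero]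
    · obtain rfl | ⟨a, b, h, -, rfl⟩ := hF hH
      · exact inf_le_left
      · exact inf_blockSubmodule_le_edgeHyperplane_iff.2 (Quot.sound ⟨h, hH⟩)
  · obtain ⟨y, hy, hy₀⟩ := SetLike.not_le_iff_exists.1 hinf
    rw [mem_hyperplaneAtInfinity] at hy₀
    have hgain {a b : Γ.V} {h : G} (hab : edgeHyperplane a b (h : K) ∈ F) :
        y (some a) / y none - y (some b) / y none = h := by
      rw [← sub_div, (mem_edgeHyperplane _ _ _ y).1 (sInf_le hab hy), mul_div_cancel_right₀ _ hy₀]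
    -- A common solution off `{z = 0}`, divided by its coordinate `z`, is a potential up to
    -- constants.
    obtain ⟨p, hp⟩ := exists_potential r (fun a => y (some a) / y none)
      fun a b ⟨h, hab⟩ => hgain hab ▸ h.2
    have hpot {a b : Γ.V} {h : G} (hab : edgeHyperplane a b (h : K) ∈ F) : p a - p b = h :=
      Subtype.ext ((hp a b ⟨h, hab⟩).trans (hgain hab))
    refine ⟨p, .inr (le_antisymm ?_ (le_sInf fun H hH => ?_))⟩
    · exact le_blockSubmodule_quot_iff.2 fun a b ⟨h, hab⟩ => hpot hab ▸ sInf_le hab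
    · obtain rfl | ⟨a, b, h, -, rfl⟩ := hF hH
      · exact (hy₀ (sInf_le hH hy)).elim
      · exact blockSubmodule_le_edgeHyperplane_iff.2 ⟨Quot.sound ⟨h, hH⟩, hpot hH⟩

theorem card_points_le_sInf {F : Set (Submodule K (Option Γ.V → K))}
    (hF : F ⊆ Γ.extendedLiftArrangement.carrier) (k : ℕ) :
    ((Nat.card (Colour G k) : ℤ) - 1) *
          Nat.card {x : Γ.V → Colour G k // finitePoint x ≤ sInf F} +
        Nat.card {x : Γ.V → Colour G k // infinitePoint x ≤ sInf F} =
      (Nat.card (Colour G k) : ℤ) ^ Module.finrank K ↥(sInf F) := by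
  obtain ⟨ι, f, p, hL | hL⟩ := Γ.exists_sInf_eq hF <;> rw [hL]
  · have hfinite (x : Γ.V → Colour G k) :
        ¬ finitePoint x ≤ hyperplaneAtInfinity K Γ.V ⊓ blockSubmodule f p :=
      fun h => not_blockSubmodule_le_hyperplaneAtInfinity _ _ (h.trans inf_le_left)
    have hinfinite (x : Γ.V → Colour G k) :
        infinitePoint x ≤ hyperplaneAtInfinity K Γ.V ⊓ blockSubmodule f p ↔
          infinitePoint x ≤ blockSubmodule f p := by
      exact le_inf_iff.trans (and_iff_right inf_le_left)
    have := Subtype.isEmpty_of_false hfinite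
    rw [Nat.card_of_isEmpty (α := {x // finitePoint x ≤ _}),
      Nat.card_congr (Equiv.subtypeEquivRight hinfinite), card_infinitePoint_le_blockSubmodule,
      finrank_inf_blockSubmodule]
    simp
  · rw [card_finitePoint_le_blockSubmodule, card_infinitePoint_le_blockSubmodule,
      finrank_blockSubmodule]
    push_cast
    ring

/-- The factor `t - 1` arises since a colouring stands for all the nonzero points of a line. -/
theorem eval_charPoly_contract_mul_pow [Finite G] {X : Set (Submodule K (Option Γ.V → K))}
    (hX : Γ.extendedLiftArrangement.matroid.IsFlat X) (hX' : hyperplaneAtInfinity K Γ.V ∉ X)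
    (k : ℕ) :
    (Γ.extendedLiftArrangement.matroid.contract X).charPoly.eval (Nat.card (Colour G k) : ℤ) *
        (Nat.card (Colour G k) : ℤ) ^
          Module.finrank K ↥(sInf Γ.extendedLiftArrangement.carrier) =
      ((Nat.card (Colour G k) : ℤ) - 1) * Nat.card {x : Γ.V → Colour G k //
        {H | H ∈ Γ.extendedLiftArrangement.carrier ∧ finitePoint x ≤ H} = X} := by
  classical
  have := Fintype.ofFinite (Γ.V → Colour G k)
  have hinfinite : IsEmpty {x : Γ.V → Colour G k //
      {H | H ∈ Γ.extendedLiftArrangement.carrier ∧ infinitePoint x ≤ H} = X} :=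
    ⟨fun x => hX' (x.2 ▸ ⟨.inl rfl, inf_le_left⟩)⟩
  rw [Γ.extendedLiftArrangement.eval_charPoly_contract_mul hX
      (Sum.elim (finitePoint (G := G) (k := k)) (infinitePoint (G := G) (k := k)))
      (Sum.elim (fun _ => (Nat.card (Colour G k) : ℤ) - 1) fun _ => 1),
    sum_filter_sumElim]
  · simp only [Sum.elim_inl, Sum.elim_inr, Nat.card_of_isEmpty, Nat.cast_zero, mul_zero, add_zero]
  · intro F hF
    rw [sum_filter_sumElim, one_mul]
    exact Γ.card_points_le_sInf hF k

end Points

section ContractionFlat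

variable {K : Type v} [Field K] {G : AddSubgroup K} (Γ : LooplessGainGraph.{u} G)

variable {ι : Type w} {f : Γ.V → ι} {p : Γ.V → G}

/-- The flat of `M(A_+(Γ))` of the hyperplanes containing a block: the edges that become loops of
gain `0` when the fibres of `f` are identified by means of the potential `p`. -/
def contractionFlat (f : Γ.V → ι) (p : Γ.V → G) : Set (Submodule K (Option Γ.V → K)) :=
  {H | H ∈ Γ.extendedLiftArrangement.carrier ∧ blockSubmodule f p ≤ H}

/-- The fibres of `f`, with the potential `p`, are connected by edges of `Γ`, so that
`Γ.toGainGraph.contract f p` arises by contracting edges. -/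
def IsContraction (f : Γ.V → ι) (p : Γ.V → G) : Prop :=
  sInf (Γ.contractionFlat f p) ≤ blockSubmodule f p

theorem isFlat_contractionFlat (f : Γ.V → ι) (p : Γ.V → G) :
    Γ.extendedLiftArrangement.matroid.IsFlat (Γ.contractionFlat f p) :=
  Γ.extendedLiftArrangement.isFlat_setOf_le _

theorem hyperplaneAtInfinity_notMem_contractionFlat (f : Γ.V → ι) (p : Γ.V → G) :
    hyperplaneAtInfinity K Γ.V ∉ Γ.contractionFlat f p :=
  fun h => not_blockSubmodule_le_hyperplaneAtInfinity f p h.2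

theorem edgeHyperplane_mem_contractionFlat {a b : Γ.V} {h : G} (hab : Γ.Adj a b h)
    (hf : f a = f b) (hp : p a - p b = h) : edgeHyperplane a b (h : K) ∈ Γ.contractionFlat f p :=
  ⟨.inr ⟨a, b, h, hab, rfl⟩, blockSubmodule_le_edgeHyperplane_iff.2 ⟨hf, hp⟩⟩

variable {Γ}

theorem IsContraction.sInf_eq (hp : Γ.IsContraction f p) :
    sInf (Γ.contractionFlat f p) = blockSubmodule f p :=
  hp.antisymm (le_sInf fun _ hH => hH.2)

theorem IsContraction.eRk_eq {f : Γ.V → Γ.V} (hp : Γ.IsContraction f p) :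
    Γ.extendedLiftArrangement.matroid.eRk (Γ.contractionFlat f p) = (Set.range f)ᶜ.ncard := by
  have := Fintype.ofFinite Γ.V
  have h := (blockSubmodule f p).finrank_quotient_add_finrank
  have hcompl := (Set.range f).ncard_add_ncard_compl
  rw [finrank_blockSubmodule, Module.finrank_fintype_fun_eq_card, Fintype.card_option,
    ← Nat.card_eq_fintype_card] at h
  rw [Γ.extendedLiftArrangement.eRk_eq_codim fun _ hH => hH.1, hp.sInf_eq, Nat.cast_inj]
  omega

theorem IsContraction.setOf_finitePoint_le_eq_iff (hp : Γ.IsContraction f p) {k : ℕ}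
    {x : Γ.V → Colour G k} :
    {H | H ∈ Γ.extendedLiftArrangement.carrier ∧ finitePoint x ≤ H} = Γ.contractionFlat f p ↔
      finitePoint x ≤ blockSubmodule f p ∧ ∀ a b h, Γ.Adj a b h → x a = h +ᵥ x b → f a = f b := by
  constructor
  · refine fun hx => ⟨(le_sInf fun H hH => ?_).trans hp, fun a b h hab hxab => ?_⟩
    · exact (hx.superset hH).2
    · have hmem := hx.subset ⟨.inr ⟨a, b, h, hab, rfl⟩, finitePoint_le_edgeHyperplane_iff.2 hxab⟩
      exact (blockSubmodule_le_edgeHyperplane_iff.1 hmem.2).1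
  · rintro ⟨hx, hedge⟩
    refine Set.Subset.antisymm ?_ fun H hH => ⟨hH.1, hx.trans hH.2⟩
    rintro H ⟨rfl | ⟨a, b, h, hab, rfl⟩, hxH⟩
    · exact (not_blockSubmodule_le_hyperplaneAtInfinity _ _ hxH).elim
    · have hxab := finitePoint_le_edgeHyperplane_iff.1 hxH
      have hf := hedge a b h hab hxab
      have hpot : -p a +ᵥ x a = -p b +ᵥ x b := finitePoint_le_blockSubmodule_iff.1 hx hf
      rw [neg_vadd_eq_iff, vadd_vadd, hxab, ← sub_eq_add_neg] at hpot
      exact Γ.edgeHyperplane_mem_contractionFlat hab hf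
        (IsCancelVAdd.right_cancel _ _ _ hpot).symm

end ContractionFlat

section IsContraction

variable {K : Type v} [Field K] {G : AddSubgroup K} {Γ : LooplessGainGraph.{u} G}
  {ι : Type w} {f : Γ.V → ι} {p : Γ.V → G}

theorem IsContraction.numProper_eq [Finite ι] (hp : Γ.IsContraction f p) (k : ℕ) :
    (Γ.toGainGraph.contract f p).numProper k =
      Nat.card {x : Γ.V → Colour G k //
          {H | H ∈ Γ.extendedLiftArrangement.carrier ∧ finitePoint x ≤ H} =
            Γ.contractionFlat f p} *
        Nat.card (Colour G k) ^ (Set.range f)ᶜ.ncard := by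
  let switch : (Γ.V → Colour G k) ≃ (Γ.V → Colour G k) :=
    Equiv.piCongrRight fun a => AddAction.toPerm (-p a)
  let Q (z : Γ.V → Colour G k) : Prop :=
    ∀ a b h, Γ.Adj a b h → f a ≠ f b → p a +ᵥ z a ≠ h +ᵥ p b +ᵥ z b
  have hQ (y : ι → Colour G k) : (Γ.toGainGraph.contract f p).IsProper y ↔ Q (y ∘ f) :=
    GainGraph.isProper_contract_iff
  have hx (x : Γ.V → Colour G k) :
      {H | H ∈ Γ.extendedLiftArrangement.carrier ∧ finitePoint x ≤ H} = Γ.contractionFlat f p ↔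
        Function.FactorsThrough (switch x) f ∧ Q (switch x) := by
    rw [hp.setOf_finitePoint_le_eq_iff, finitePoint_le_blockSubmodule_iff]
    refine and_congr Iff.rfl (forall₄_congr fun a b h _ => ?_)
    simp only [switch, Equiv.piCongrRight_apply, Pi.map_apply, AddAction.toPerm_apply,
      vadd_neg_vadd]
    exact not_imp_not.symm
  rw [GainGraph.numProper, Nat.card_congr (Equiv.subtypeEquivRight hQ), card_subtype_comp,
    ← Nat.card_congr (switch.subtypeEquiv hx)]

variable [Finite G]

theorem IsContraction.eval_charPoly_contract_mul_pow [Finite ι] (hp : Γ.IsContraction f p) (k : ℕ) :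
    (Γ.extendedLiftArrangement.matroid.contract (Γ.contractionFlat f p)).charPoly.eval
          (Nat.card (Colour G k) : ℤ) *
        (Nat.card (Colour G k) : ℤ) ^
          (Module.finrank K ↥(sInf Γ.extendedLiftArrangement.carrier) + (Set.range f)ᶜ.ncard) =
      ((Nat.card (Colour G k) : ℤ) - 1) * (Γ.toGainGraph.contract f p).numProper k := by
  rw [pow_add, ← mul_assoc, Γ.eval_charPoly_contract_mul_pow (Γ.isFlat_contractionFlat f p)
    (Γ.hyperplaneAtInfinity_notMem_contractionFlat f p), hp.numProper_eq, mul_assoc]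
  push_cast
  rfl

theorem IsContraction.charPoly_contract_dvd {f f' : Γ.V → Γ.V} {p p' : Γ.V → G}
    (hp : Γ.IsContraction f p) (hp' : Γ.IsContraction f' p')
    (hcard : (Set.range f')ᶜ.ncard = (Set.range f)ᶜ.ncard + 1)
    (hdvd : (Γ.toGainGraph.contract f p).CountDvd (Γ.toGainGraph.contract f' p')) :
    (Γ.extendedLiftArrangement.matroid.contract (Γ.contractionFlat f' p')).charPoly ∣
      (Γ.extendedLiftArrangement.matroid.contract (Γ.contractionFlat f p)).charPoly := by
  obtain ⟨q, hq⟩ := hdvd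
  refine ⟨q, eq_of_infinite_eval_eq _ _ (Set.infinite_of_injective_forall_mem
    (f := fun k : ℕ => (Nat.card (Colour G (Nat.card Γ.V + k + 1)) : ℤ)) ?_ fun k => ?_)⟩
  · intro k k' hkk'
    simpa [Colour.card_eq, Nat.card_pos.ne'] using hkk'
  · have h₀ : (Nat.card (Colour G (Nat.card Γ.V + k + 1)) : ℤ) ≠ 0 := by
      rw [Colour.card_eq]
      exact_mod_cast Nat.mul_ne_zero Nat.card_pos.ne' (Nat.succ_ne_zero _)
    have h := hp.eval_charPoly_contract_mul_pow (Nat.card Γ.V + k + 1)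
    have h' := hp'.eval_charPoly_contract_mul_pow (Nat.card Γ.V + k + 1)
    have hk := hq (Nat.card Γ.V + k + 1) (by omega)
    rw [hcard, ← add_assoc, pow_succ] at h'
    rw [Set.mem_ofPred_eq, eval_mul]
    generalize Module.finrank K ↥(sInf Γ.extendedLiftArrangement.carrier) +
      (Set.range f)ᶜ.ncard = m at h h'
    generalize (Nat.card (Colour G (Nat.card Γ.V + k + 1)) : ℤ) = t at h₀ h h' hk ⊢
    refine mul_right_cancel₀ (mul_ne_zero (pow_ne_zero m h₀) h₀) ?_
    linear_combination t * h + (t - 1) * hk - q.eval t * h'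

end IsContraction

section Chain

variable {K : Type v} [Field K] {G : AddSubgroup K} {Γ : LooplessGainGraph.{u} G}

theorem contractionFlat_id : Γ.contractionFlat id 0 = ∅ := by
  refine Set.eq_empty_of_forall_notMem ?_
  rintro H ⟨rfl | ⟨a, b, h, hab, rfl⟩, hH⟩
  · exact not_blockSubmodule_le_hyperplaneAtInfinity _ _ hH
  · exact Γ.ne_of_adj hab (blockSubmodule_le_edgeHyperplane_iff.1 hH).1

theorem isContraction_id : Γ.IsContraction id 0 := by
  rintro y - a b (rfl : a = b)
  simp

variable {ι : Type w} {f : Γ.V → ι} {p : Γ.V → G}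

open Classical in
theorem contractionFlat_subset_elim {c d : Γ.V} {g : G} :
    Γ.contractionFlat f p ⊆ Γ.contractionFlat (Function.update id (f d) (f c) ∘ f)
      fun a => p a + (Pi.single (f d) (-g) : ι → G) (f a) := by
  refine fun H hH => ⟨hH.1, le_trans ?_ hH.2⟩
  refine le_blockSubmodule_iff.2 fun a b hab => blockSubmodule_le_edgeHyperplane_iff.2 ?_
  simp [hab]

open Classical in
theorem IsContraction.elim (hp : Γ.IsContraction f p) {c d : Γ.V} {g : G} (hcd : f c ≠ f d)
    (hadj : Γ.Adj c d (g + p c - p d)) :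
    Γ.IsContraction (Function.update id (f d) (f c) ∘ f)
      fun a => p a + (Pi.single (f d) (-g) : ι → G) (f a) := by
  refine le_trans (le_inf ((sInf_le_sInf contractionFlat_subset_elim).trans hp) (sInf_le ?_))
    (inf_edgeHyperplane_le_blockSubmodule f p c d g)
  refine Γ.edgeHyperplane_mem_contractionFlat hadj ?_ ?_
  · simp [hcd]
  · rw [Pi.single_eq_of_ne hcd, Pi.single_eq_same]
    abel

theorem IsContraction.sInf_carrier_eq (hp : Γ.IsContraction f p)
    (hE : Γ.toGainGraph.contract f p = GainGraph.complete ∅) :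
    sInf Γ.extendedLiftArrangement.carrier =
      hyperplaneAtInfinity K Γ.V ⊓ blockSubmodule f p := by
  refine le_antisymm (le_inf (sInf_le (.inl rfl)) ?_) (le_sInf ?_)
  · exact (sInf_le_sInf fun _ hH => hH.1).trans hp
  · rintro _ (rfl | ⟨a, b, h, hab, rfl⟩)
    · exact inf_le_left
    · refine inf_blockSubmodule_le_edgeHyperplane_iff.2 (not_imp_comm.1 (fun hf => ?_) id)
      have hadj : (Γ.toGainGraph.contract f p).Adj (f a) (f b) (h - p a + p b) := by
        refine ⟨hf, a, b, rfl, rfl, ?_⟩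
        rwa [show h - p a + p b + p a - p b = h by abel]
      rw [hE] at hadj
      exact hadj.1

theorem IsContraction.eRank_eq {f : Γ.V → Γ.V} (hp : Γ.IsContraction f p)
    (hE : Γ.toGainGraph.contract f p = GainGraph.complete ∅) :
    Γ.extendedLiftArrangement.matroid.eRank = ((Set.range f)ᶜ.ncard + 1 : ℕ) := by
  have := Fintype.ofFinite Γ.V
  have h := (hyperplaneAtInfinity K Γ.V ⊓ blockSubmodule f p).finrank_quotient_add_finrank
  have hcompl := (Set.range f).ncard_add_ncard_compl
  rw [finrank_inf_blockSubmodule, Module.finrank_fintype_fun_eq_card, Fintype.card_option,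
    ← Nat.card_eq_fintype_card] at h
  rw [← Matroid.eRk_ground, Arrangement.matroid_ground, Arrangement.eRk_eq_codim _ subset_rfl,
    hp.sInf_carrier_eq hE, Nat.cast_inj]
  omega

end Chain

end LooplessGainGraph

theorem GainGraph.ContractsOnto.divisionalChain {K : Type v} [Field K] {G : AddSubgroup K}
    [Finite G] {Γ : LooplessGainGraph.{u} G} {A : GainGraph Γ.V G} (hA : A.ContractsOnto ∅)
    {f : Γ.V → Γ.V} {p : Γ.V → G} (hAf : Γ.toGainGraph.contract f p = A)
    (hp : Γ.IsContraction f p) :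
    DivisionalChain Γ.extendedLiftArrangement.matroid (Set.range f)ᶜ.ncard
      (Γ.contractionFlat f p) := by
  induction hA generalizing f p with
  | complete =>
    refine .step (Γ.isFlat_contractionFlat f p) hp.eRk_eq (fun _ hH => hH.1) ?_
      (.ground (hp.eRank_eq hAf))
    rw [← Arrangement.matroid_ground, FlatLattice.charPoly_contract_ground]
    exact one_dvd _
  | @elim _ _ _ g _ huv hdvd _ ih =>
    classical
    subst hAf
    obtain ⟨hcd, c, d, rfl, rfl, hadj⟩ := huv
    have hp' := hp.elim hcd hadj
    have helim := (Γ.toGainGraph.contract_contract f p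
      (Function.update id (f d) (f c)) (Pi.single (f d) (-g))).symm
    have hcard := ncard_compl_range_update_comp f hcd
    have hflag := hcard ▸ ih helim hp'
    exact .step (Γ.isFlat_contractionFlat f p) hp.eRk_eq
      LooplessGainGraph.contractionFlat_subset_elim
      (hp.charPoly_contract_dvd hp' hcard (helim ▸ hdvd)) hflag

theorem mainTheorem4 {K : Type v} [Field K] (G : AddSubgroup K) [Finite G]
    (Γ : LooplessGainGraph.{u} G) (hΓ : LooplessGainGraph.ExtendedLiftClass G Γ) :
    Γ.extendedLiftArrangement.DivisionallyFree := by
  have hA : Γ.toGainGraph.ContractsOnto ∅ := by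
    have h := hΓ.contractsOnto (f := id) Function.injective_id (W := ∅) fun _ _ _ h => h.1.elim
    rwa [GainGraph.contract_id] at h
  have hchain := hA.divisionalChain Γ.toGainGraph.contract_id LooplessGainGraph.isContraction_id
  rw [LooplessGainGraph.contractionFlat_id, Set.range_id, Set.compl_univ, Set.ncard_empty] at hchain
  exact hchain.exists_isDivisionalFlag
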